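/- **Setting.** Let $X$ be the set of families $p=(p_{k,l})_{(k,l)\in\mathbb Z^2}$ in $\mathbb Z/2\mathbb Z$ with $p_{k,l}+p_{k+1,l}+p_{k,l+1}=0$ for all $k,l$, with the product topology, and $(Tp)_{k,l}=p_{k+1,l}$, $(Sp)_{k,l}=p_{k,l+1}$. Let $Y=\{p\in X: p_{0,0}=1\}$, and for $p,q\in Y$ write $p\sim q$ if $q\neq p$ and $q\in\{Tp,Sp,T^{-1}Sp,T^{-1}p,S^{-1}p,TS^{-1}p\}$. Let $p_0\in Y$ be given by $(p_0)_{-k,-l}=(p_0)_{k+l+1,-l}=\binom{k+l}{k} \bmod 2$ for $k,l\ge 0$, all other coordinates being $0$. Let $\Gamma=Y\cap\{T^kS^lp_0 : k,l\in\mathbb Z\}$ (the Pascal graph), and let $\bar\Gamma$ be the closure of $\Gamma$ in $Y$; $\sim$ makes it a graph in which every point has three neighbours. For $\varphi:\bar\Gamma\to\mathbb C$ put $\bar\Delta\varphi(p)=\sum_{q\sim p}\varphi(q)$. Let $\mathfrak S\subset GL_2(\mathbb Z)$ be the subgroup generated by $\begin{pmatrix}-1&-1\\0&1\end{pmatrix}$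 and $\begin{pmatrix}0&1\\-1&-1\end{pmatrix}$; it acts on $\bar\Gamma$ by $(sp)_{k,l}=p_{s^{-1}(k,l)}$. Reduction mod $2$ identifies $\mathfrak S$ with the group of permutations of the three vectors $a=(1,1)$, $b=(0,1)$, $c=(1,0)$ of $(\mathbb Z/2\mathbb Z)^2$; let $\varepsilon:\mathfrak S\to\{\pm1\}$ be the signature. For $r\in Y$ let $\hat r^a,\hat r^b,\hat r^c\in Y$ be the points such that, for all $k,l\in\mathbb Z$, - $\hat r^a_{2k,2l}=\hat r^a_{2k-1,2l}=\hat r^a_{2k,2l-1}=r_{k,l}$ and $\hat r^a_{2k-1,2l-1}=0$; - $\hat r^b_{2k,2l}=\hat r^b_{2k+1,2l}=\hat r^b_{2k+1,2l-1}=r_{k,l}$ and $\hat r^b_{2k+2,2l-1}=0$; - $\hat r^c_{2k,2l}=\hat r^c_{2k,2l+1}=\hat r^c_{2k-1,2l+1}=r_{k,l}$ and $\hat r^c_{2k-1,2l+2}=0$. Every $p\in\bar\Gamma$ is $\hat r^d$ for a unique $d\in\{a,b,c\}$ and a unique $r\in Y$, and this $r$ lies in $\bar\Gamma$; put $\theta_1(p)=d$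 and $\bar\Pi p=r$. Let $\mathcal T_1$ be the complete graph on three vertices $a_1,b_1,c_1$. For $n\ge1$, $\mathcal T_{n+1}$ is obtained from $\mathcal T_n$ by replacing each point by a triangle: its points are the couples $(p,q)$ with $p\sim q$ in $\mathcal T_n$, together with three vertices $a_{n+1},b_{n+1},c_{n+1}$ lying above $a_n,b_n,c_n$ respectively (the couple $(p,q)$ lies above $p$); two distinct points lying above the same point are neighbours, $(p,q)\sim(q,p)$, and there are no other edges. An $n$-triangle of $\bar\Gamma$ is a subset whose induced graph is isomorphic to $\mathcal T_n$; its vertices are the points corresponding to $a_n,b_n,c_n$. Let $\theta_n:\bar\Gamma\to\mathcal T_n$ be the unique map which restricts to a graph isomorphism from each $n$-triangle of $\bar\Gamma$ onto $\mathcal T_n$ and which sends a vertex $p$ of an $n$-triangle to $a_n$, $b_n$ or $c_n$ according as $\theta_1(\bar\Pi^{n-1}p)$ is $a$, $b$ or $c$. A function $\varphi:\bar\Gamma\to\mathbb C$ is $n$-triangular if $\varphi=\psi\circ\theta_n$ for some $\psi:\mathcal T_n\to\mathbb C$. It is $\mathfrak S$-invariant if $\varphi\circ s=\varphi$ for all $s\in\mathfrak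 S$, and $(\mathfrak S,\varepsilon)$-semi-invariant if $\varphi\circ s=\varepsilon(s)\varphi$ for all $s\in\mathfrak S$. Let $f=X^2-X-3$, and let $f^p$ be its $p$-th iterate under composition ($f^0=X$). **Proposition 13.6.** For every integer $n\ge1$, the (finite-dimensional) space of $\mathfrak S$-invariant $n$-triangular functions on $\bar\Gamma$ is stable under $\bar\Delta$, and the characteristic polynomial of $\bar\Delta$ on it is $$(X-3)\prod_{p=0}^{n-2}\bigl(f^p(X)\bigr)^{\frac{3^{n-2-p}+2n-2p-1}{4}}\bigl(f^p(X)+2\bigr)^{\frac{3^{n-2-p}-2n+2p+3}{4}}.$$ For every integer $n\ge2$, the (finite-dimensional) space of $(\mathfrak S,\varepsilon)$-semi-invariant $n$-triangular functions on $\bar\Gamma$ is stable under $\bar\Delta$, and the characteristic polynomial of $\bar\Delta$ on it is $$\prod_{p=0}^{n-2}\bigl(f^p(X)\bigr)^{\frac{3^{n-2-p}-2n+2p+3}{4}}\bigl(f^p(X)+2\bigr)^{\frac{3^{n-2-p}+2n-2p-1}{4}}.$$ -/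

import Mathlib

open Polynomial

namespace PascalGraph

/-- Families `(p_{k,l})` of elements of `ℤ/2ℤ` indexed by `ℤ²`, with the product topology. -/
abbrev Config : Type := ℤ × ℤ → ZMod 2

/-- The translate `T^k S^l p` of `p`, where `d = (k, l)`. -/
def shift (d : ℤ × ℤ) (p : Config) : Config := fun x => p (x + d)

/-- The three dot system `X`. -/
def threeDot : Set Config :=
  {p | ∀ k l : ℤ, p (k, l) + p (k + 1, l) + p (k, l + 1) = 0}

/-- The set `Y` of the points `p` of `X` with `p_{0,0} = 1`. -/
def pointed : Set Config := {p | p ∈ threeDot ∧ p (0, 0) = 1}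

/-- The six directions joining a point of `ℤ²` to its neighbours. -/
def directions : Finset (ℤ × ℤ) := {(1, 0), (0, 1), (-1, 1), (-1, 0), (0, -1), (1, -1)}

theorem neg_mem_directions {d : ℤ × ℤ} (h : d ∈ directions) : -d ∈ directions := by
  simp only [directions, Finset.mem_insert, Finset.mem_singleton] at h ⊢
  rcases h with rfl | rfl | rfl | rfl | rfl | rfl <;> decide

theorem shift_neg_shift (d : ℤ × ℤ) (p : Config) : shift (-d) (shift d p) = p := by
  funext x; simp [shift]

/-- `p ∼ q` when `q` is one of `Tp, Sp, T⁻¹Sp, T⁻¹p, S⁻¹p, TS⁻¹p`. -/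
def configGraph : SimpleGraph Config where
  Adj p q := p ≠ q ∧ ∃ d ∈ directions, q = shift d p
  symm := ⟨by
    rintro p q ⟨hne, d, hd, rfl⟩
    exact ⟨hne.symm, -d, neg_mem_directions hd, (shift_neg_shift d p).symm⟩⟩
  loopless := ⟨fun _ h => h.1 rfl⟩

/-- The base point `p₀`: for `k, l ≥ 0`, `p_{-k,-l} = p_{k+l+1,-l} = binom (k+l) k` mod `2`, and all
the other coordinates are `0`. -/
def basePoint : Config := fun x =>
  if 0 < x.2 then 0
  else if x.1 ≤ 0 then (Nat.choose (-x.1 - x.2).toNat (-x.1).toNat : ZMod 2)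
  else if 1 ≤ x.1 + x.2 then (Nat.choose (x.1 - 1).toNat (x.1 + x.2 - 1).toNat : ZMod 2)
  else 0

/-- The Pascal graph `Γ`, seen as the set of the translates of `p₀` that belong to `Y`. -/
def pascal : Set Config := {q | q ∈ pointed ∧ ∃ d : ℤ × ℤ, q = shift d basePoint}

/-- The planar compactification `Γ̄`: the closure of `Γ` in `Y`. -/
def pascalBar : Set Config := pointed ∩ closure pascal

/-- The graph structure of `Γ̄`. -/
def barGraph : SimpleGraph pascalBar := configGraph.induce pascalBar

theorem finite_neighborSet (p : pascalBar) : (barGraph.neighborSet p).Finite := by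
  refine Set.Finite.of_finite_image (f := Subtype.val) ?_ Subtype.val_injective.injOn
  refine ((directions : Set (ℤ × ℤ)).toFinite.image fun d => shift d p.1).subset ?_
  rintro _ ⟨q, hq, rfl⟩
  obtain ⟨-, d, hd, h⟩ := hq
  exact ⟨d, hd, h.symm⟩

/-- The operator `Δ̄` on functions on `Γ̄`: sum over the neighbours. -/
noncomputable def laplacian : (pascalBar → ℂ) →ₗ[ℂ] (pascalBar → ℂ) where
  toFun φ p := ∑ q ∈ (finite_neighborSet p).toFinset, φ q
  map_add' φ ψ := by funext p; simp [Finset.sum_add_distrib]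
  map_smul' c φ := by funext p; simp [Finset.mul_sum]

/-! ### The group `𝔖` and its action -/

/-- The element `i` of `GL₂(ℤ)`. -/
def elemI : GL (Fin 2) ℤ :=
  ⟨!![-1, -1; 0, 1], !![-1, -1; 0, 1], by decide, by decide⟩

/-- The element `r` of `GL₂(ℤ)`. -/
def elemR : GL (Fin 2) ℤ :=
  ⟨!![0, 1; -1, -1], !![-1, -1; 1, 0], by decide, by decide⟩

/-- The subgroup `𝔖` of `GL₂(ℤ)` generated by `i` and `r`. -/
def symGroup : Subgroup (GL (Fin 2) ℤ) := Subgroup.closure {elemI, elemR}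

/-- The action `(s p)_{k,l} = p_{s⁻¹(k,l)}`. -/
def act (s : GL (Fin 2) ℤ) (p : Config) : Config := fun x =>
  let y : Fin 2 → ℤ := (s⁻¹ : GL (Fin 2) ℤ).val.mulVec ![x.1, x.2]
  p (y 0, y 1)

/-- The permutation of `(ℤ/2ℤ)²` induced by an element of `GL₂(ℤ)`. It fixes `0` and permutes
`a = (1, 1)`, `b = (0, 1)`, `c = (1, 0)`. -/
noncomputable def permMod2 (s : GL (Fin 2) ℤ) : Equiv.Perm (Fin 2 → ZMod 2) :=
  (LinearMap.GeneralLinearGroup.generalLinearEquiv (ZMod 2) (Fin 2 → ZMod 2)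
    (Matrix.GeneralLinearGroup.toLin
      (Matrix.GeneralLinearGroup.map (Int.castRingHom (ZMod 2)) s))).toEquiv

/-- The signature `ε`: the sign of the permutation of `{a, b, c}`. On `𝔖`, the permutation of
`{a, b, c}` is the one which identifies `𝔖` with the symmetric group on three letters. -/
noncomputable def signature (s : GL (Fin 2) ℤ) : ℤˣ := Equiv.Perm.sign (permMod2 s)

/-! ### Substitution of triangles -/

/-- The three labels `a`, `b`, `c`. -/
inductive Corner : Type
  | a
  | b
  | c
  deriving DecidableEq

/-- `p` is the point `r̂^d` obtained from `r` by replacing each point by a triangle. -/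
def IsHat (r : Config) : Corner → Config → Prop
  | Corner.a, p => ∀ k l : ℤ, p (2 * k, 2 * l) = r (k, l) ∧ p (2 * k - 1, 2 * l) = r (k, l) ∧
      p (2 * k, 2 * l - 1) = r (k, l) ∧ p (2 * k - 1, 2 * l - 1) = 0
  | Corner.b, p => ∀ k l : ℤ, p (2 * k, 2 * l) = r (k, l) ∧ p (2 * k + 1, 2 * l) = r (k, l) ∧
      p (2 * k + 1, 2 * l - 1) = r (k, l) ∧ p (2 * k + 2, 2 * l - 1) = 0
  | Corner.c, p => ∀ k l : ℤ, p (2 * k, 2 * l) = r (k, l) ∧ p (2 * k, 2 * l + 1) = r (k, l) ∧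
      p (2 * k - 1, 2 * l + 1) = r (k, l) ∧ p (2 * k - 1, 2 * l + 2) = 0

/-- `θ₁(p) = d`, that is, `p = r̂^d` for some `r` in `Y`. -/
def HasLabel (p : Config) (d : Corner) : Prop := ∃ r ∈ pointed, IsHat r d p

/-- The contraction of triangles `Π̄`: if `p = r̂^d`, then `Π̄ p = r`. -/
def contract (p : Config) : Config := fun x => p (2 * x.1, 2 * x.2)

theorem contract_eq_of_isHat {r p : Config} {d : Corner} (h : IsHat r d p) : contract p = r := by
  funext x
  cases d <;> exact (h x.1 x.2).1

/-! ### The abstract `n`-triangles -/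

/-- A graph with three labelled points. -/
structure CorneredGraph : Type 1 where
  /-- the points -/
  V : Type
  /-- the graph structure -/
  graph : SimpleGraph V
  /-- the three labelled points -/
  corner : Corner → V

/-- Replacing each point by a triangle, for a graph whose points have three neighbours except for
the labelled points, which have two. The points of the new graph are the labelled points and
the couples `(p, q)` with `p ∼ q`. The couple `(p, q)` is joined to `(q, p)` and to the other points
above `p`, and these are the couples `(p, q')` and, if `p` is a labelled point, `p` itself. -/
def hatAdj (G : CorneredGraph) : Corner ⊕ G.graph.Dart → Corner ⊕ G.graph.Dart → Prop
  | Sum.inl _, Sum.inl _ => False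
  | Sum.inl d, Sum.inr e => e.fst = G.corner d
  | Sum.inr e, Sum.inl d => e.fst = G.corner d
  | Sum.inr e, Sum.inr e' => (e.fst = e'.fst ∧ e.snd ≠ e'.snd) ∨ (e.fst = e'.snd ∧ e.snd = e'.fst)

/-- The graph obtained by replacing each point by a triangle, with the same labelled points. -/
def hat (G : CorneredGraph) : CorneredGraph where
  V := Corner ⊕ G.graph.Dart
  graph :=
    { Adj := hatAdj G
      symm := ⟨by
        rintro (d | e) (d' | e') h
        · exact h
        · exact h
        · exact h
        · rcases h with ⟨h1, h2⟩ | ⟨h1, h2⟩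
          · exact Or.inl ⟨h1.symm, h2.symm⟩
          · exact Or.inr ⟨h2.symm, h1.symm⟩⟩
      loopless := ⟨by
        rintro (d | e) h
        · exact h
        · rcases h with ⟨-, h2⟩ | ⟨h1, -⟩
          · exact h2 rfl
          · exact e.adj.ne h1⟩ }
  corner := Sum.inl

/-- The `n`-triangle `𝒯_n` with vertices `a_n, b_n, c_n`: a single point for `n = 0`, the complete
graph on `{a, b, c}` for `n = 1`, and `𝒯_{n+1}` is obtained from `𝒯_n` by replacing each
point by a triangle. -/
def triangle : ℕ → CorneredGraph
  | 0 => ⟨Unit, ⊥, fun _ => ()⟩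
  | 1 => ⟨Corner, ⊤, id⟩
  | n + 2 => hat (triangle (n + 1))

/-- The `n`-triangles of `Γ̄`. -/
def IsTriangle (n : ℕ) (S : Set pascalBar) : Prop :=
  Nonempty (barGraph.induce S ≃g (triangle n).graph)

/-! ### Triangular functions -/

/-- The properties that define `θ_n : Γ̄ → 𝒯_n`: on each `n`-triangle `S` of `Γ̄`, it is
a graph isomorphism onto `𝒯_n`, and the vertex of `S` sent to the vertex of `𝒯_n` with label `d` is the
one with `θ₁(Π̄^{n-1} p) = d`. -/
def IsCoding (n : ℕ) (θ : pascalBar → (triangle n).V) : Prop :=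
  ∀ S : Set pascalBar, IsTriangle n S →
    Set.BijOn θ S Set.univ ∧
    (∀ p ∈ S, ∀ q ∈ S, barGraph.Adj p q ↔ (triangle n).graph.Adj (θ p) (θ q)) ∧
    (1 ≤ n → ∀ p ∈ S, ∀ d : Corner, θ p = (triangle n).corner d →
      HasLabel (contract^[n - 1] p.1) d)

instance (n : ℕ) : Nonempty (pascalBar → (triangle n).V) :=
  ⟨fun _ => (triangle n).corner Corner.a⟩

/-- The map `θ_n : Γ̄ → 𝒯_n`, the unique map with the properties above. -/
noncomputable def coding (n : ℕ) : pascalBar → (triangle n).V := Classical.epsilon (IsCoding n)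

/-- The space of the `n`-triangular functions, those of the form `ψ ∘ θ_n`. -/
noncomputable def triangular (n : ℕ) : Submodule ℂ (pascalBar → ℂ) :=
  LinearMap.range (LinearMap.funLeft ℂ ℂ (coding n))

/-- The functions `φ` on `Γ̄` such that `φ ∘ s = χ(s) φ` for all `s` in `𝔖` (the set `Γ̄` is stable under
`𝔖`, and `q` stands for the point `s p`). -/
def semiInvariant (χ : GL (Fin 2) ℤ → ℤˣ) : Submodule ℂ (pascalBar → ℂ) where
  carrier := {φ | ∀ s ∈ symGroup, ∀ p q : pascalBar, q.1 = act s p.1 →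
    φ q = ((χ s : ℤ) : ℂ) * φ p}
  add_mem' := by
    intro φ ψ hφ hψ s hs p q h
    simp only [Pi.add_apply, hφ s hs p q h, hψ s hs p q h, mul_add]
  zero_mem' := by intro s _ p q _; simp
  smul_mem' := by
    intro c φ hφ s hs p q h
    simp only [Pi.smul_apply, smul_eq_mul, hφ s hs p q h]
    ring

/-- The space of the `𝔖`-invariant `n`-triangular functions. -/
noncomputable def invTriangular (n : ℕ) : Submodule ℂ (pascalBar → ℂ) :=
  triangular n ⊓ semiInvariant fun _ => 1

/-- The space of the `(𝔖, ε)`-semi-invariant `n`-triangular functions. -/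
noncomputable def signTriangular (n : ℕ) : Submodule ℂ (pascalBar → ℂ) :=
  triangular n ⊓ semiInvariant signature

/-! ### The polynomials -/

/-- The iterate `f^p` of the polynomial `f = X² - X - 3`. -/
noncomputable def fIter (p : ℕ) : ℂ[X] := (X ^ 2 - X - 3 : ℂ[X]).comp^[p] X

/-- `(3^{n-2-p} + 2n - 2p - 1) / 4` -/
def expPlus (n p : ℕ) : ℕ := (3 ^ (n - 2 - p) + 2 * n - 2 * p - 1) / 4

/-- `(3^{n-2-p} - 2n + 2p + 3) / 4` -/
def expMinus (n p : ℕ) : ℕ := (3 ^ (n - 2 - p) + 2 * p + 3 - 2 * n) / 4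

/-- The truncated operations in the exponents are exact in the range where they are used. -/
theorem exp_exact {n p : ℕ} (h : p + 2 ≤ n) :
    4 * (expPlus n p : ℤ) = 3 ^ (n - 2 - p) + 2 * n - 2 * p - 1 ∧
    4 * (expMinus n p : ℤ) = 3 ^ (n - 2 - p) - 2 * n + 2 * p + 3 := by
  obtain ⟨m, rfl⟩ := Nat.exists_eq_add_of_le h
  have hm : p + 2 + m - 2 - p = m := by omega
  have key : ∀ m : ℕ, 2 * m + 1 ≤ 3 ^ m ∧ ((3 ^ m - 2 * m - 1 : ℤ)) % 4 = 0 := by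
    intro m
    induction m with
    | zero => simp
    | succ m ih =>
      obtain ⟨h1, h2⟩ := ih
      refine ⟨by rw [pow_succ]; omega, ?_⟩
      rw [pow_succ]
      push_cast
      omega
  obtain ⟨h1, h2⟩ := key m
  have h3 : ((3 ^ m : ℕ) : ℤ) = 3 ^ m := by push_cast; rfl
  unfold expPlus expMinus
  rw [hm, ← h3]
  rw [← h3] at h2
  generalize 3 ^ m = N at *
  push_cast
  constructor <;> omega

end PascalGraph

open PascalGraph

/-!
Label each point of `Γ̄` by the word of the letters `θ₁(p), θ₁(Π̄ p), …, θ₁(Π̄ⁿ⁻¹ p)`, its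
address. For `r` in `Γ̄` and `d ≠ e`, the edge of label `d` at `r̂^e` leads to `r̂^d`, while the
edge of label `d` at `r̂^d` leads to the triangle of the neighbour of `r` in the direction `d`
(`isCross_hatEquiv_of_ne`, `IsCross.hatEquiv`). So adjacency inside an `n`-triangle is read off
the addresses, by the involution `tau` which reverses edges; the `n`-triangles are exactly the
fibres of `Π̄ⁿ`, any parametrization of one of them is the address up to a permutation of the
letters (`exists_eq_fillEquiv_of_embedding`), and `θₙ` is the address map (`exists_coding_eq`).
The group `𝔖` acts on addresses letter by letter, through all the permutations of `{a, b, c}`.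
It preserves `Γ̄` because the images of `p₀` under the generators are a translate of `p₀` and a
limit of translates of `p₀` (`act_elemI_basePoint`, `act_elemR_basePoint_mem_closure`).

Hence the two spaces of the theorem are spaces of functions on words of length `n` that are
equivariant for a character `χ` of the symmetric group, and `Δ̄` becomes the adjacency operator
`Δₙ` of the `n`-triangle with a loop at each vertex (`laplacian_onBar`). Let `U` be the
pull-back from words of length `n` to words of length `n + 1`, `D` the sum over the first letter and
`T` the composition with `tau`. Then `Δₙ₊₁ = U D - 1 + T`, `Δₙ = D T U`, `D U = 3` and `T² = 1`,
and the identity `det (1 - A B) = det (1 - B A)` gives, with `f = X² - X - 3` and `dₙ` the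
dimension for words of length `n`, `charpoly Δₙ₊₁ * (X (X + 2)) ^ dₙ = (charpoly T)(X + 1) *
(charpoly Δₙ)(f)` (`charpoly_mul_pow_finrank`). As `T` is an involution, its characteristic
polynomial is known from its trace and the dimension. Both are computed by splitting the words
of length `n + 2` into those which begin with a repeated letter, which amount to words of length
`n + 1`, and those which begin with two distinct letters, on which the symmetric group acts
freely (`splitEquiv`). For the trivial character, the factor `f - 3 = (X - 3) (X + 2)` explains
the different shape of the formula.
-/

namespace PascalGraph

/-! ### Translates and substitution of triangles -/

theorem shift_apply (u x : ℤ × ℤ) (p : Config) : shift u p x = p (x + u) := rfl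

theorem shift_shift (u v : ℤ × ℤ) (p : Config) : shift u (shift v p) = shift (u + v) p := by
  funext x; simp only [shift, add_assoc]

theorem shift_zero (p : Config) : shift 0 p = p := by
  funext x; simp only [shift, add_zero]

theorem continuous_shift (v : ℤ × ℤ) : Continuous (shift v) :=
  continuous_pi fun x => continuous_apply (x + v)

theorem shift_mem_threeDot {p : Config} (hp : p ∈ threeDot) (v : ℤ × ℤ) :
    shift v p ∈ threeDot := by
  intro k l
  have h := hp (k + v.1) (l + v.2)
  rwa [show k + v.1 + 1 = k + 1 + v.1 by ring, show l + v.2 + 1 = l + 1 + v.2 by ring] at h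

/-- Position of the point of label `d` relative to the point of label `a` in a triangle. -/
def offset : Corner → ℤ × ℤ
  | Corner.a => (0, 0)
  | Corner.b => (-1, 0)
  | Corner.c => (0, -1)

/-- The configuration `r̂^a`. -/
def double (r : Config) : Config := fun x =>
  if x.1 % 2 = 1 ∧ x.2 % 2 = 1 then 0 else r ((x.1 + 1) / 2, (x.2 + 1) / 2)

/-- The configuration `r̂^d`. -/
def hatConfig (d : Corner) (r : Config) : Config := shift (offset d) (double r)

theorem double_eq_zero (r : Config) {x y : ℤ} (hx : x % 2 = 1) (hy : y % 2 = 1) :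
    double r (x, y) = 0 := if_pos ⟨hx, hy⟩

theorem double_eq (r : Config) {x y : ℤ} (k l : ℤ) (h : x % 2 = 0 ∨ y % 2 = 0)
    (hk : k = (x + 1) / 2) (hl : l = (y + 1) / 2) : double r (x, y) = r (k, l) := by
  subst hk hl
  exact if_neg (fun h' => by omega)

theorem double_shift (v : ℤ × ℤ) (r : Config) : double (shift v r) = shift (v + v) (double r) := by
  funext ⟨x, y⟩
  obtain ⟨u, v⟩ := v
  change double _ (x, y) = double r (x + (u + u), y + (v + v))
  by_cases h : x % 2 = 1 ∧ y % 2 = 1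
  · rw [double_eq_zero _ h.1 h.2, double_eq_zero] <;> omega
  · rw [double_eq _ _ _ (by omega) rfl rfl,
      double_eq r ((x + 1) / 2 + u) ((y + 1) / 2 + v) (by omega) (by omega) (by omega)]
    rfl

theorem double_offset (d : Corner) (r : Config) : double r (offset d) = r (0, 0) := by
  cases d <;> simp [double, offset]

theorem hatConfig_zero (d : Corner) (r : Config) : hatConfig d r (0, 0) = r (0, 0) := by
  rw [← double_offset d r, hatConfig, shift_apply, Prod.mk_zero_zero, zero_add]

theorem isHat_hatConfig (r : Config) (d : Corner) : IsHat r d (hatConfig d r) := by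
  cases d <;> intro k l <;> refine ⟨?_, ?_, ?_, ?_⟩ <;>
    first
    | exact double_eq_zero r (by simp only [offset]; omega) (by simp only [offset]; omega)
    | exact double_eq r k l (by simp only [offset]; omega) (by simp only [offset]; omega)
        (by simp only [offset]; omega)

theorem IsHat.unique {r p q : Config} {d : Corner} (hp : IsHat r d p) (hq : IsHat r d q) :
    p = q := by
  funext ⟨x, y⟩
  -- the four residues of `(x, y)` modulo `2` are those of the four points in `IsHat`
  cases d
  all_goals
    have hx := Int.emod_two_eq_zero_or_one x
    have hy := Int.emod_two_eq_zero_or_one y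
  · have h1 := hp ((x + 1) / 2) ((y + 1) / 2)
    have h2 := hq ((x + 1) / 2) ((y + 1) / 2)
    have e1 : x = 2 * ((x + 1) / 2) ∨ x = 2 * ((x + 1) / 2) - 1 := by omega
    have e2 : y = 2 * ((y + 1) / 2) ∨ y = 2 * ((y + 1) / 2) - 1 := by omega
    clear hx hy
    generalize (x + 1) / 2 = k at *
    generalize (y + 1) / 2 = l at *
    rcases e1 with rfl | rfl <;> rcases e2 with rfl | rfl
    exacts [h1.1.trans h2.1.symm, h1.2.2.1.trans h2.2.2.1.symm, h1.2.1.trans h2.2.1.symm,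
      h1.2.2.2.trans h2.2.2.2.symm]
  · have h1 := hp (x / 2) ((y + 1) / 2)
    have h2 := hq (x / 2) ((y + 1) / 2)
    have h1' := (hp ((x - 2) / 2) ((y + 1) / 2)).2.2.2
    have h2' := (hq ((x - 2) / 2) ((y + 1) / 2)).2.2.2
    rw [show 2 * ((x - 2) / 2) + 2 = 2 * (x / 2) by omega] at h1' h2'
    have e1 : x = 2 * (x / 2) ∨ x = 2 * (x / 2) + 1 := by omega
    have e2 : y = 2 * ((y + 1) / 2) ∨ y = 2 * ((y + 1) / 2) - 1 := by omega
    clear hx hy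
    generalize x / 2 = k at *
    generalize (y + 1) / 2 = l at *
    rcases e1 with rfl | rfl <;> rcases e2 with rfl | rfl
    exacts [h1.1.trans h2.1.symm, h1'.trans h2'.symm, h1.2.1.trans h2.2.1.symm,
      h1.2.2.1.trans h2.2.2.1.symm]
  · have h1 := hp ((x + 1) / 2) (y / 2)
    have h2 := hq ((x + 1) / 2) (y / 2)
    have h1' := (hp ((x + 1) / 2) ((y - 2) / 2)).2.2.2
    have h2' := (hq ((x + 1) / 2) ((y - 2) / 2)).2.2.2
    rw [show 2 * ((y - 2) / 2) + 2 = 2 * (y / 2) by omega] at h1' h2'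
    have e1 : x = 2 * ((x + 1) / 2) ∨ x = 2 * ((x + 1) / 2) - 1 := by omega
    have e2 : y = 2 * (y / 2) ∨ y = 2 * (y / 2) + 1 := by omega
    clear hx hy
    generalize y / 2 = k at *
    generalize (x + 1) / 2 = l at *
    rcases e1 with rfl | rfl <;> rcases e2 with rfl | rfl
    exacts [h1.1.trans h2.1.symm, h1.2.1.trans h2.2.1.symm, h1'.trans h2'.symm,
      h1.2.2.1.trans h2.2.2.1.symm]

theorem isHat_iff {r p : Config} {d : Corner} : IsHat r d p ↔ p = hatConfig d r :=
  ⟨fun h => h.unique (isHat_hatConfig r d), fun h => h ▸ isHat_hatConfig r d⟩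

theorem contract_hatConfig (d : Corner) (r : Config) : contract (hatConfig d r) = r :=
  contract_eq_of_isHat (isHat_iff.2 rfl)

theorem hatConfig_shift (d : Corner) (v : ℤ × ℤ) (r : Config) :
    hatConfig d (shift v r) = shift (offset d + (v + v)) (double r) := by
  rw [hatConfig, double_shift, shift_shift]

theorem label_injective {d d' : Corner} {r r' : Config} (hr : r (0, 0) = 1)
    (h : hatConfig d r = hatConfig d' r') : d = d' := by
  by_contra hne
  -- the third label `e` marks a zero of `r̂'^d'` where `r̂^d` takes the value `r (0, 0)`
  have key : ∀ e, double r' (offset e - offset d + offset d') = 0 → False := by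
    intro e he
    have h1 : hatConfig d r (offset e - offset d) = 1 := by
      rw [hatConfig, shift_apply, sub_add_cancel, double_offset, hr]
    rw [h, hatConfig, shift_apply, he] at h1
    exact zero_ne_one h1
  cases d <;> cases d' <;> first
    | exact hne rfl
    | exact key Corner.a (double_eq_zero r' (by decide) (by decide))
    | exact key Corner.b (double_eq_zero r' (by decide) (by decide))
    | exact key Corner.c (double_eq_zero r' (by decide) (by decide))

theorem double_mem_threeDot {r : Config} (hr : r ∈ threeDot) : double r ∈ threeDot := by
  have h2 : ∀ z : ZMod 2, z + z = 0 := by decide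
  intro x y
  simp only [double]
  rcases Int.emod_two_eq_zero_or_one x with hx | hx <;>
    rcases Int.emod_two_eq_zero_or_one y with hy | hy
  · rw [if_neg (by omega), if_neg (by omega), if_neg (by omega), ← hr ((x + 1) / 2) ((y + 1) / 2)]
    congr 3
    · congr 1; omega
    · omega
  · rw [if_neg (by omega), if_pos (by omega), if_neg (by omega),
      show (y + 1 + 1) / 2 = (y + 1) / 2 by omega, add_zero, h2]
  · rw [if_neg (by omega), if_neg (by omega), if_pos (by omega),
      show (x + 1 + 1) / 2 = (x + 1) / 2 by omega, add_zero, h2]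
  · rw [if_pos (by omega), if_neg (by omega), if_neg (by omega),
      show (x + 1 + 1) / 2 = (x + 1) / 2 by omega, show (y + 1 + 1) / 2 = (y + 1) / 2 by omega,
      zero_add, h2]

theorem hatConfig_mem_pointed {r : Config} (hr : r ∈ pointed) (d : Corner) :
    hatConfig d r ∈ pointed :=
  ⟨shift_mem_threeDot (double_mem_threeDot hr.1) _, by rw [hatConfig_zero, hr.2]⟩

theorem continuous_double : Continuous double := by
  refine continuous_pi fun x => ?_
  unfold double
  split_ifs
  · exact continuous_const
  · exact continuous_apply _

theorem continuous_hatConfig (d : Corner) : Continuous (hatConfig d) :=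
  (continuous_shift _).comp continuous_double

theorem continuous_contract : Continuous contract :=
  continuous_pi fun x => continuous_apply (2 * x.1, 2 * x.2)

theorem basePoint_of_pos {x y : ℤ} (hy : 0 < y) : basePoint (x, y) = 0 := if_pos hy

theorem basePoint_of_nonpos {x y : ℤ} (n k : ℕ) (hy : y ≤ 0) (hx : x ≤ 0) (hn : (n : ℤ) = -x - y)
    (hk : (k : ℤ) = -x) : basePoint (x, y) = n.choose k := by
  simp only [basePoint]
  rw [if_neg (by omega), if_pos hx, ← hn, ← hk, Int.toNat_natCast, Int.toNat_natCast]

theorem basePoint_of_one_le {x y : ℤ} (n k : ℕ) (hy : y ≤ 0) (hn : (n : ℤ) = x - 1)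
    (hk : (k : ℤ) = x + y - 1) : basePoint (x, y) = n.choose k := by
  simp only [basePoint]
  rw [if_neg (by omega), if_neg (by omega), if_pos (by omega), ← hn, ← hk, Int.toNat_natCast,
    Int.toNat_natCast]

theorem basePoint_of_add_nonpos {x y : ℤ} (hx : 0 < x) (hxy : x + y ≤ 0) :
    basePoint (x, y) = 0 := by
  simp only [basePoint]
  rw [if_neg (by omega), if_neg (by omega), if_neg (by omega)]

theorem basePoint_row_zero (k : ℤ) : basePoint (k, 0) = 1 := by
  rcases le_or_gt k 0 with h | h
  · rw [basePoint_of_nonpos (-k).toNat (-k).toNat le_rfl h (by omega) (by omega), Nat.choose_self,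
      Nat.cast_one]
  · rw [basePoint_of_one_le (k - 1).toNat (k - 1).toNat le_rfl (by omega) (by omega),
      Nat.choose_self, Nat.cast_one]

theorem basePoint_mem_threeDot : basePoint ∈ threeDot := by
  have h2 : ∀ z : ZMod 2, z + z = 0 := by decide
  intro k l
  rcases lt_trichotomy l 0 with hl | rfl | hl
  · rcases lt_trichotomy k 0 with hk | rfl | hk
    · obtain ⟨K, hK⟩ : ∃ K : ℕ, (K : ℤ) = -k - 1 := ⟨(-k - 1).toNat, by omega⟩
      obtain ⟨L, hL⟩ : ∃ L : ℕ, (L : ℤ) = -l - 1 := ⟨(-l - 1).toNat, by omega⟩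
      rw [basePoint_of_nonpos (K + L + 1 + 1) (K + 1) (by omega) (by omega) (by omega) (by omega),
        basePoint_of_nonpos (K + L + 1) K (by omega) (by omega) (by omega) (by omega),
        basePoint_of_nonpos (K + L + 1) (K + 1) (by omega) (by omega) (by omega) (by omega),
        Nat.choose_succ_succ', Nat.cast_add, add_assoc, h2]
    · rw [basePoint_of_nonpos (-l).toNat 0 (by omega) (by omega) (by omega) (by omega),
        basePoint_of_add_nonpos (by omega) (by omega),
        basePoint_of_nonpos (-l - 1).toNat 0 (by omega) (by omega) (by omega) (by omega),
        Nat.choose_zero_right, Nat.choose_zero_right, add_zero, h2]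
    · obtain ⟨K, hK⟩ : ∃ K : ℕ, (K : ℤ) = k - 1 := ⟨(k - 1).toNat, by omega⟩
      rcases lt_trichotomy (k + l) 0 with h | h | h
      · rw [basePoint_of_add_nonpos hk (by omega), basePoint_of_add_nonpos (by omega) (by omega),
          basePoint_of_add_nonpos hk (by omega)]
        rfl
      · rw [basePoint_of_add_nonpos hk (by omega),
          basePoint_of_one_le (K + 1) 0 (by omega) (by omega) (by omega),
          basePoint_of_one_le K 0 (by omega) (by omega) (by omega),
          Nat.choose_zero_right, Nat.choose_zero_right, zero_add, h2]
      · obtain ⟨M, hM⟩ : ∃ M : ℕ, (M : ℤ) = k + l - 1 := ⟨(k + l - 1).toNat, by omega⟩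
        rw [basePoint_of_one_le K M (by omega) (by omega) (by omega),
          basePoint_of_one_le (K + 1) (M + 1) (by omega) (by omega) (by omega),
          basePoint_of_one_le K (M + 1) (by omega) (by omega) (by omega),
          Nat.choose_succ_succ, Nat.cast_add, ← add_assoc, h2, zero_add, h2]
  · rw [basePoint_row_zero, basePoint_row_zero, basePoint_of_pos (by omega), add_zero, h2]
  · rw [basePoint_of_pos hl, basePoint_of_pos hl, basePoint_of_pos (by omega)]
    rfl

theorem choose_zmod_two (n k : ℕ) :
    (n.choose k : ZMod 2) =
      ((n % 2).choose (k % 2) : ZMod 2) * ((n / 2).choose (k / 2) : ZMod 2) := by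
  have h := (ZMod.natCast_eq_natCast_iff _ _ _).2
    (Choose.choose_modEq_choose_mod_mul_choose_div_nat (n := n) (k := k) (p := 2))
  rw [h]; push_cast; rfl

/-- By Lucas' theorem modulo `2`, the base point is its own image under `r ↦ r̂^a`. -/
theorem double_basePoint : double basePoint = basePoint := by
  funext ⟨x, y⟩
  have hev : ∀ n k N K : ℕ, (n % 2 = 1 ∨ k % 2 = 0) → N = n / 2 → K = k / 2 →
      (N.choose K : ZMod 2) = n.choose k := by
    rintro n k _ _ h rfl rfl
    rw [choose_zmod_two n k]
    rcases Nat.mod_two_eq_zero_or_one n with h1 | h1 <;>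
    rcases Nat.mod_two_eq_zero_or_one k with h2 | h2 <;> simp [h1, h2]; omega
  have hodd : ∀ n k : ℕ, n % 2 = 0 → k % 2 = 1 → (n.choose k : ZMod 2) = 0 := by
    intro n k h1 h2
    rw [choose_zmod_two n k]; simp [h1, h2]
  simp only [double, basePoint]
  by_cases hxy : x % 2 = 1 ∧ y % 2 = 1
  · rw [if_pos hxy]
    split_ifs
    · rfl
    · rw [hodd] <;> omega
    · rw [hodd] <;> omega
    · rfl
  · rw [if_neg hxy]
    split_ifs <;> first | rfl | omega | exact hev _ _ _ _ (by omega) (by omega) (by omega)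

/-! ### The base point and the closure of its translates -/

theorem basePoint_eq_hatConfig : hatConfig Corner.a basePoint = basePoint := by
  rw [hatConfig, double_basePoint]; exact shift_zero _

theorem shift_basePoint_mem_pascal {v : ℤ × ℤ} (h : basePoint v = 1) :
    shift v basePoint ∈ pascal :=
  ⟨⟨shift_mem_threeDot basePoint_mem_threeDot v, by rwa [shift_apply, Prod.mk_zero_zero, zero_add]⟩,
    v, rfl⟩

theorem hatConfig_mem_pascal {r : Config} (hr : r ∈ pascal) (d : Corner) :
    hatConfig d r ∈ pascal := by
  obtain ⟨hp, v, rfl⟩ := hr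
  exact ⟨hatConfig_mem_pointed hp d, _, by rw [hatConfig_shift, double_basePoint]⟩

theorem exists_eq_hatConfig_of_mem_pascal {p : Config} (hp : p ∈ pascal) :
    ∃ d, ∃ r ∈ pascal, p = hatConfig d r := by
  obtain ⟨⟨-, h0⟩, ⟨x, y⟩, rfl⟩ := hp
  have key : ∀ d u, (x, y) = offset d + (u + u) →
      ∃ d, ∃ r ∈ pascal, shift (x, y) basePoint = hatConfig d r := by
    intro d u hu
    have he : shift (x, y) basePoint = hatConfig d (shift u basePoint) := by
      rw [hatConfig_shift, double_basePoint, hu]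
    refine ⟨d, _, shift_basePoint_mem_pascal ?_, he⟩
    rw [he, hatConfig_zero, shift_apply, Prod.mk_zero_zero, zero_add] at h0
    exact h0
  rcases Int.emod_two_eq_zero_or_one x with hx | hx <;>
    rcases Int.emod_two_eq_zero_or_one y with hy | hy
  · exact key Corner.a (x / 2, y / 2) (by simp only [offset, Prod.mk_add_mk]; congr 1 <;> omega)
  · exact key Corner.c (x / 2, (y + 1) / 2)
      (by simp only [offset, Prod.mk_add_mk]; congr 1 <;> omega)
  · exact key Corner.b ((x + 1) / 2, y / 2)
      (by simp only [offset, Prod.mk_add_mk]; congr 1 <;> omega)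
  · rw [shift_apply, Prod.mk_zero_zero, zero_add, ← double_basePoint, double_eq_zero _ hx hy] at h0
    exact absurd h0 zero_ne_one

theorem contract_mem_pascal {p : Config} (hp : p ∈ pascal) : contract p ∈ pascal := by
  obtain ⟨d, r, hr, rfl⟩ := exists_eq_hatConfig_of_mem_pascal hp
  rwa [contract_hatConfig]

theorem hatConfig_mem_closure {r : Config} (hr : r ∈ closure pascal) (d : Corner) :
    hatConfig d r ∈ closure pascal :=
  map_mem_closure (continuous_hatConfig d) hr fun _ h => hatConfig_mem_pascal h d

theorem contract_mem_closure {r : Config} (hr : r ∈ closure pascal) :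
    contract r ∈ closure pascal :=
  map_mem_closure continuous_contract hr fun _ h => contract_mem_pascal h

theorem exists_eq_hatConfig_contract {p : Config} (hp : p ∈ closure pascal) :
    ∃ d, p = hatConfig d (contract p) := by
  have hcl : ∀ d, IsClosed {p | p = hatConfig d (contract p)} := fun d =>
    isClosed_eq continuous_id ((continuous_hatConfig d).comp continuous_contract)
  have h := closure_minimal (s := pascal) (t := ({p | p = hatConfig Corner.a (contract p)} ∪
    {p | p = hatConfig Corner.b (contract p)}) ∪ {p | p = hatConfig Corner.c (contract p)})
    (fun q hq => by
      obtain ⟨d, r, -, rfl⟩ := exists_eq_hatConfig_of_mem_pascal hq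
      simp only [Set.mem_union, Set.mem_ofPred_eq, contract_hatConfig]
      cases d
      exacts [Or.inl (Or.inl rfl), Or.inl (Or.inr rfl), Or.inr rfl])
    (((hcl _).union (hcl _)).union (hcl _)) hp
  rcases h with (h | h) | h
  exacts [⟨_, h⟩, ⟨_, h⟩, ⟨_, h⟩]

theorem closure_pascal_subset_threeDot : closure pascal ⊆ threeDot := by
  refine closure_minimal (fun _ h => h.1.1) ?_
  simp only [threeDot, Set.ofPred_forall]
  refine isClosed_iInter fun k => isClosed_iInter fun l => isClosed_eq ?_ continuous_const
  have h : Continuous fun z : ZMod 2 × ZMod 2 × ZMod 2 => z.1 + z.2.1 + z.2.2 :=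
    continuous_of_discreteTopology
  have e : ∀ x, Continuous fun p : Config => p x := fun x => continuous_apply x
  exact h.comp ((e (k, l)).prodMk ((e (k + 1, l)).prodMk (e (k, l + 1))))

theorem mem_pascalBar_iff {p : Config} : p ∈ pascalBar ↔ p ∈ closure pascal ∧ p (0, 0) = 1 :=
  ⟨fun h => ⟨h.2, h.1.2⟩, fun h => ⟨⟨closure_pascal_subset_threeDot h.1, h.2⟩, h.1⟩⟩

/-- To see that `f` sends a point `p` with `f p v = 1` into the closure of `Γ`, it suffices to
consider the points of `Γ` with this property, because this is an open condition. -/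
theorem map_mem_closure_pascal {f : Config → Config} (hf : Continuous f) {v : ℤ × ℤ}
    (h : ∀ q ∈ pascal, f q v = 1 → f q ∈ closure pascal) {p : Config} (hp : p ∈ closure pascal)
    (hv : f p v = 1) : f p ∈ closure pascal := by
  have hopen : IsOpen {q : Config | f q v = 1} :=
    (isOpen_discrete {(1 : ZMod 2)}).preimage ((continuous_apply v).comp hf)
  have hp' : p ∈ closure (pascal ∩ {q | f q v = 1}) := by
    rw [Set.inter_comm]
    exact hopen.inter_closure ⟨hv, hp⟩
  have := map_mem_closure hf hp' (t := closure pascal) fun q hq => h q hq.1 hq.2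
  rwa [closure_closure] at this

theorem shift_mem_closure {p : Config} (hp : p ∈ closure pascal) {v : ℤ × ℤ} (hv : p v = 1) :
    shift v p ∈ closure pascal := by
  refine map_mem_closure_pascal (continuous_shift v) (v := (0, 0)) ?_ hp
    (by rwa [shift_apply, Prod.mk_zero_zero, zero_add])
  rintro _ ⟨-, u, rfl⟩ hq
  rw [shift_shift] at hq ⊢
  exact subset_closure (shift_basePoint_mem_pascal
    (by rwa [shift_apply, Prod.mk_zero_zero, zero_add] at hq))

theorem basePoint_mem_pascalBar : basePoint ∈ pascalBar := by
  refine mem_pascalBar_iff.2 ⟨subset_closure ?_, basePoint_row_zero 0⟩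
  have := shift_basePoint_mem_pascal (v := 0) (basePoint_row_zero 0)
  rwa [shift_zero] at this

/-! ### The self-similar structure of `Γ̄` -/

/-- The bijection `(d, r) ↦ r̂^d` of `{a, b, c} × Γ̄` onto `Γ̄`. -/
noncomputable def hatEquiv : Corner × pascalBar ≃ pascalBar :=
  Equiv.ofBijective
    (fun x => ⟨hatConfig x.1 x.2.1, mem_pascalBar_iff.2
      ⟨hatConfig_mem_closure x.2.2.2 _, by rw [hatConfig_zero, x.2.2.1.2]⟩⟩) <| by
    constructor
    · rintro ⟨d, r⟩ ⟨d', r'⟩ h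
      have h' : hatConfig d r.1 = hatConfig d' r'.1 := congrArg Subtype.val h
      obtain rfl := label_injective r.2.1.2 h'
      refine Prod.ext rfl (Subtype.ext ?_)
      rw [← contract_hatConfig d r.1, h', contract_hatConfig]
    · rintro ⟨p, hp⟩
      obtain ⟨hp, h0⟩ := mem_pascalBar_iff.1 hp
      obtain ⟨d, hd⟩ := exists_eq_hatConfig_contract hp
      exact ⟨(d, ⟨contract p, mem_pascalBar_iff.2 ⟨contract_mem_closure hp, h0⟩⟩),
        Subtype.ext hd.symm⟩

theorem coe_hatEquiv (d : Corner) (r : pascalBar) :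
    (hatEquiv (d, r) : Config) = hatConfig d r := rfl

theorem hatEquiv_inj {d d' : Corner} {r r' : pascalBar} :
    hatEquiv (d, r) = hatEquiv (d', r') ↔ d = d' ∧ r = r' := by
  rw [hatEquiv.apply_eq_iff_eq, Prod.mk.injEq]

theorem exists_eq_hatEquiv (p : pascalBar) : ∃ d r, p = hatEquiv (d, r) :=
  ⟨(hatEquiv.symm p).1, (hatEquiv.symm p).2, (hatEquiv.apply_symm_apply p).symm⟩

/-- `IsCross d p d' q`: the edge of label `d` at `p` joins `p` to `q`, and has label `d'` at `q`. An
edge is labelled at `p` by the label of the point above `p` that it goes out of when the points are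
replaced by triangles. -/
def IsCross (d : Corner) (p : pascalBar) (d' : Corner) (q : pascalBar) : Prop :=
  d ≠ d' ∧ p.1 (offset d - offset d') = 1 ∧ q.1 = shift (offset d - offset d') p.1

theorem IsCross.symm {d d' : Corner} {p q : pascalBar} (h : IsCross d p d' q) :
    IsCross d' q d p := by
  obtain ⟨hne, -, hq⟩ := h
  have e : offset d' - offset d = -(offset d - offset d') := by abel
  refine ⟨hne.symm, ?_, ?_⟩
  · rw [hq, shift_apply, e, neg_add_cancel]
    exact p.2.1.2
  · rw [hq, shift_shift, e, neg_add_cancel, shift_zero]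

theorem three_relations (p : pascalBar) : p.1 (0, 0) + p.1 (1, 0) + p.1 (0, 1) = 0 ∧
    p.1 (-1, 0) + p.1 (0, 0) + p.1 (-1, 1) = 0 ∧ p.1 (0, -1) + p.1 (1, -1) + p.1 (0, 0) = 0 :=
  ⟨p.2.1.1 0 0, p.2.1.1 (-1) 0, p.2.1.1 0 (-1)⟩

/-- Each label `d` corresponds to one of the three relations of the three dot system which involve
the origin. As the value at the origin is `1`, one of the two other values is `1`. -/
theorem exists_isCross (d : Corner) (p : pascalBar) : ∃ d' q, IsCross d p d' q := by
  have key : ∀ d', d ≠ d' → p.1 (offset d - offset d') = 1 → ∃ d' q, IsCross d p d' q := by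
    intro d' hne h
    exact ⟨d', ⟨_, mem_pascalBar_iff.2 ⟨shift_mem_closure p.2.2 h,
      by rwa [shift_apply, Prod.mk_zero_zero, zero_add]⟩⟩, hne, h, rfl⟩
  have hsum : ∀ x y z : ZMod 2, x + y + z = 0 →
      (x = 1 → y = 1 ∨ z = 1) ∧ (y = 1 → x = 1 ∨ z = 1) ∧ (z = 1 → x = 1 ∨ y = 1) := by decide
  have h0 := p.2.1.2
  cases d
  · rcases (hsum _ _ _ (three_relations p).1).1 h0 with h | h
    exacts [key Corner.b (by decide) h, key Corner.c (by decide) h]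
  · rcases (hsum _ _ _ (three_relations p).2.1).2.1 h0 with h | h
    exacts [key Corner.a (by decide) h, key Corner.c (by decide) h]
  · rcases (hsum _ _ _ (three_relations p).2.2).2.2 h0 with h | h
    exacts [key Corner.a (by decide) h, key Corner.b (by decide) h]

theorem IsCross.unique {d d' d'' : Corner} {p q q' : pascalBar} (h : IsCross d p d' q)
    (h' : IsCross d p d'' q') : d' = d'' ∧ q = q' := by
  obtain ⟨hne, h1, hq⟩ := h
  obtain ⟨hne', h1', hq'⟩ := h'
  have hdd : d' = d'' := by
    by_contra hdd
    have hsum : ∀ x y z : ZMod 2, x + y + z = 0 → x = 1 → y = 1 → z = 1 → False := by decide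
    have h0 := p.2.1.2
    have t1 := hsum _ _ _ (three_relations p).1
    have t2 := hsum _ _ _ (three_relations p).2.1
    have t3 := hsum _ _ _ (three_relations p).2.2
    cases d <;> cases d' <;> cases d'' <;> first
      | exact hne rfl
      | exact hne' rfl
      | exact hdd rfl
      | exact t1 h0 h1 h1'
      | exact t1 h0 h1' h1
      | exact t2 h1 h0 h1'
      | exact t2 h1' h0 h1
      | exact t3 h1 h1' h0
      | exact t3 h1' h1 h0
  subst hdd
  exact ⟨rfl, Subtype.ext (hq.trans hq'.symm)⟩

theorem isCross_hatEquiv_of_ne {d e : Corner} (h : d ≠ e) (r : pascalBar) :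
    IsCross d (hatEquiv (e, r)) e (hatEquiv (d, r)) := by
  refine ⟨h, ?_, ?_⟩
  · rw [coe_hatEquiv, hatConfig, shift_apply, sub_add_cancel, double_offset, r.2.1.2]
  · rw [coe_hatEquiv, coe_hatEquiv, hatConfig, hatConfig, shift_shift, sub_add_cancel]

theorem IsCross.hatEquiv {d d' : Corner} {r r' : pascalBar} (h : IsCross d r d' r') :
    IsCross d (hatEquiv (d, r)) d' (hatEquiv (d', r')) := by
  obtain ⟨hne, h1, hq⟩ := h
  set v := offset d - offset d' with hv
  have e : v + offset d = offset d' + (v + v) := by rw [hv]; abel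
  have hs : hatConfig d' (shift v r.1) = shift v (hatConfig d r.1) := by
    rw [hatConfig_shift, hatConfig, shift_shift, e]
  refine ⟨hne, ?_, ?_⟩
  · rw [coe_hatEquiv, ← hv]
    have := hatConfig_zero d' (shift v r.1)
    rw [hs, shift_apply, shift_apply, Prod.mk_zero_zero, zero_add] at this
    rw [this, h1]
  · rw [coe_hatEquiv, coe_hatEquiv, hq, hs, hv]

/-- No point of `Γ̄` is fixed by the translation along one of its edges, because the ends of an edge
have different values of `θ₁`. -/
theorem IsCross.ne {d d' : Corner} {p q : pascalBar} (h : IsCross d p d' q) : p ≠ q := by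
  rintro rfl
  obtain ⟨e, r, rfl⟩ := exists_eq_hatEquiv p
  by_cases hde : d = e
  · subst hde
    obtain ⟨f, r', hr⟩ := exists_isCross d r
    have := h.unique hr.hatEquiv
    rw [hatEquiv_inj] at this
    exact hr.1 this.2.1
  · have := h.unique (isCross_hatEquiv_of_ne hde r)
    rw [hatEquiv_inj] at this
    exact hde this.2.1.symm

theorem barGraph_adj_iff {p q : pascalBar} : barGraph.Adj p q ↔ ∃ d d', IsCross d p d' q := by
  constructor
  · rintro ⟨-, v, hv, hq⟩
    change q.1 = shift v p.1 at hq
    have h1 : p.1 v = 1 := by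
      have := q.2.1.2
      rwa [hq, shift_apply, Prod.mk_zero_zero, zero_add] at this
    have key : ∀ d d', d ≠ d' → v = offset d - offset d' → ∃ d d', IsCross d p d' q := by
      rintro d d' hne rfl
      exact ⟨d, d', hne, h1, hq⟩
    simp only [directions, Finset.mem_insert, Finset.mem_singleton] at hv
    rcases hv with rfl | rfl | rfl | rfl | rfl | rfl
    · exact key Corner.a Corner.b (by decide) (by decide)
    · exact key Corner.a Corner.c (by decide) (by decide)
    · exact key Corner.b Corner.c (by decide) (by decide)
    · exact key Corner.b Corner.a (by decide) (by decide)
    · exact key Corner.c Corner.a (by decide) (by decide)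
    · exact key Corner.c Corner.b (by decide) (by decide)
  · rintro ⟨d, d', h⟩
    refine ⟨fun h' => h.ne (Subtype.ext h'), _, ?_, h.2.2⟩
    have := h.1
    revert this
    cases d <;> cases d' <;> decide

/-- The neighbour of `p` along the edge of label `d`. -/
noncomputable def nbr (d : Corner) (p : pascalBar) : pascalBar :=
  (exists_isCross d p).choose_spec.choose

/-- The label at the other end of the edge of label `d` at `p`. -/
noncomputable def revLabel (d : Corner) (p : pascalBar) : Corner := (exists_isCross d p).choose

theorem isCross_nbr (d : Corner) (p : pascalBar) : IsCross d p (revLabel d p) (nbr d p) :=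
  (exists_isCross d p).choose_spec.choose_spec

theorem IsCross.nbr_eq {d d' : Corner} {p q : pascalBar} (h : IsCross d p d' q) : nbr d p = q :=
  ((isCross_nbr d p).unique h).2

theorem nbr_hatEquiv_of_ne {d e : Corner} (h : d ≠ e) (r : pascalBar) :
    nbr d (hatEquiv (e, r)) = hatEquiv (d, r) := (isCross_hatEquiv_of_ne h r).nbr_eq

theorem nbr_hatEquiv_self (d : Corner) (r : pascalBar) :
    nbr d (hatEquiv (d, r)) = hatEquiv (revLabel d r, nbr d r) := (isCross_nbr d r).hatEquiv.nbr_eq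

theorem nbr_ne (d : Corner) (p : pascalBar) : nbr d p ≠ p := (isCross_nbr d p).ne.symm

theorem nbr_injective (p : pascalBar) : Function.Injective fun d => nbr d p := by
  intro d d' h
  obtain ⟨e, r, rfl⟩ := exists_eq_hatEquiv p
  simp only at h
  by_contra hne
  by_cases h1 : d = e
  · subst h1
    rw [nbr_hatEquiv_self, nbr_hatEquiv_of_ne (Ne.symm hne), hatEquiv_inj] at h
    exact nbr_ne _ _ h.2
  · rw [nbr_hatEquiv_of_ne h1] at h
    by_cases h2 : d' = e
    · subst h2
      rw [nbr_hatEquiv_self, hatEquiv_inj] at h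
      exact nbr_ne _ _ h.2.symm
    · rw [nbr_hatEquiv_of_ne h2, hatEquiv_inj] at h
      exact hne h.1

theorem IsCross.label_unique {d d' e e' : Corner} {p q : pascalBar} (h : IsCross d p d' q)
    (h' : IsCross e p e' q) : d = e ∧ d' = e' := by
  have : d = e := nbr_injective p (h.nbr_eq.trans h'.nbr_eq.symm)
  subst this
  exact ⟨rfl, (h.unique h').1⟩

theorem barGraph_adj_iff_nbr {p q : pascalBar} : barGraph.Adj p q ↔ ∃ d, q = nbr d p := by
  rw [barGraph_adj_iff]
  exact ⟨fun ⟨d, d', h⟩ => ⟨d, h.nbr_eq.symm⟩, fun ⟨d, h⟩ => ⟨d, _, h ▸ isCross_nbr d p⟩⟩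

instance : Fintype Corner := ⟨{Corner.a, Corner.b, Corner.c}, by rintro (_ | _ | _) <;> simp⟩

theorem laplacian_apply (φ : pascalBar → ℂ) (p : pascalBar) :
    laplacian φ p = ∑ d, φ (nbr d p) := by
  have h : (finite_neighborSet p).toFinset =
      Finset.univ.map ⟨fun d => nbr d p, nbr_injective p⟩ := by
    ext q
    simp only [Set.Finite.mem_toFinset, SimpleGraph.mem_neighborSet, barGraph_adj_iff_nbr,
      Finset.mem_map, Finset.mem_univ, true_and, Function.Embedding.coeFn_mk, eq_comm]
  change ∑ q ∈ (finite_neighborSet p).toFinset, φ q = _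
  rw [h, Finset.sum_map]
  rfl

/-! ### The action of `𝔖` on `Γ̄` -/

theorem act_mul (s t : GL (Fin 2) ℤ) (p : Config) : act (s * t) p = act s (act t p) := by
  funext x
  simp only [act, mul_inv_rev, Units.val_mul, ← Matrix.mulVec_mulVec]
  congr 2

theorem act_one (p : Config) : act 1 p = p := by
  funext x
  simp [act]

theorem continuous_act (s : GL (Fin 2) ℤ) : Continuous (act s) :=
  continuous_pi fun _ => continuous_apply _

theorem act_zero (s : GL (Fin 2) ℤ) (p : Config) : act s p (0, 0) = p (0, 0) := by
  simp [act, Matrix.mulVec, dotProduct, Fin.sum_univ_two]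

theorem elemI_inv : elemI⁻¹ = elemI := rfl

theorem elemR_inv : elemR⁻¹ = elemR * elemR := by
  ext i j; fin_cases i <;> fin_cases j <;> decide

theorem act_elemI (p : Config) (x y : ℤ) : act elemI p (x, y) = p (-x - y, y) := by
  change p (_, _) = _
  congr 1
  simp [elemI, Matrix.mulVec, dotProduct, Fin.sum_univ_two]
  ring

theorem act_elemR (p : Config) (x y : ℤ) : act elemR p (x, y) = p (-x - y, x) := by
  change p (_, _) = _
  congr 1
  simp [elemR, Matrix.mulVec, dotProduct, Fin.sum_univ_two]
  ring

theorem act_elemI_shift (v : ℤ × ℤ) (p : Config) :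
    act elemI (shift v p) = shift (-v.1 - v.2, v.2) (act elemI p) := by
  funext ⟨x, y⟩
  rw [act_elemI, shift_apply, shift_apply, Prod.mk_add_mk, act_elemI]
  congr 1
  ext <;> simp; ring

theorem act_elemR_shift (v : ℤ × ℤ) (p : Config) :
    act elemR (shift v p) = shift (v.2, -v.1 - v.2) (act elemR p) := by
  funext ⟨x, y⟩
  rw [act_elemR, shift_apply, shift_apply, Prod.mk_add_mk, act_elemR]
  congr 1
  ext <;> simp; ring

theorem act_elemI_isHat {d : Corner} {r p : Config} (h : IsHat r d p) :
    IsHat (act elemI r) (Equiv.swap Corner.a Corner.b d) (act elemI p) := by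
  cases d
  · change IsHat _ Corner.b _
    intro k l
    simp only [act_elemI]
    refine ⟨?_, ?_, ?_, ?_⟩
    · convert (h (-k - l) l).1 using 2; congr 1; ring
    · convert (h (-k - l) l).2.1 using 2; congr 1; ring
    · convert (h (-k - l) l).2.2.1 using 2; congr 1; ring
    · convert (h (-k - l) l).2.2.2 using 2; congr 1; ring
  · change IsHat _ Corner.a _
    intro k l
    simp only [act_elemI]
    refine ⟨?_, ?_, ?_, ?_⟩
    · convert (h (-k - l) l).1 using 2; congr 1; ring
    · convert (h (-k - l) l).2.1 using 2; congr 1; ring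
    · convert (h (-k - l) l).2.2.1 using 2; congr 1; ring
    · convert (h (-k - l) l).2.2.2 using 2; congr 1; ring
  · change IsHat _ Corner.c _
    intro k l
    simp only [act_elemI]
    refine ⟨?_, ?_, ?_, ?_⟩
    · convert (h (-k - l) l).1 using 2; congr 1; ring
    · convert (h (-k - l) l).2.2.1 using 2; congr 1; ring
    · convert (h (-k - l) l).2.1 using 2; congr 1; ring
    · convert (h (-k - l) l).2.2.2 using 2; congr 1; ring

theorem act_elemR_isHat {d : Corner} {r p : Config} (h : IsHat r d p) :
    IsHat (act elemR r) ((Equiv.swap Corner.a Corner.c * Equiv.swap Corner.b Corner.c) d)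
      (act elemR p) := by
  cases d
  · change IsHat _ Corner.c _
    intro k l
    simp only [act_elemR]
    refine ⟨?_, ?_, ?_, ?_⟩
    · convert (h (-k - l) k).1 using 2; congr 1; ring
    · convert (h (-k - l) k).2.1 using 2; congr 1; ring
    · convert (h (-k - l) k).2.2.1 using 2; congr 1; ring
    · convert (h (-k - l) k).2.2.2 using 2; congr 1; ring
  · change IsHat _ Corner.a _
    intro k l
    simp only [act_elemR]
    refine ⟨?_, ?_, ?_, ?_⟩
    · convert (h (-k - l) k).1 using 2; congr 1; ring
    · convert (h (-k - l) k).2.2.1 using 2; congr 1; ring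
    · convert (h (-k - l) k).2.1 using 2; congr 1; ring
    · convert (h (-k - l) k).2.2.2 using 2; congr 1; ring
  · change IsHat _ Corner.b _
    intro k l
    simp only [act_elemR]
    refine ⟨?_, ?_, ?_, ?_⟩
    · convert (h (-k - l) k).1 using 2; congr 1; ring
    · convert (h (-k - l) k).2.2.1 using 2; congr 1; ring
    · convert (h (-k - l) k).2.1 using 2; congr 1; ring
    · convert (h (-k - l) k).2.2.2 using 2; congr 1; ring

theorem act_elemI_hatConfig (d : Corner) (r : Config) :
    act elemI (hatConfig d r) = hatConfig (Equiv.swap Corner.a Corner.b d) (act elemI r) :=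
  isHat_iff.1 (act_elemI_isHat (isHat_hatConfig r d))

theorem act_elemR_hatConfig (d : Corner) (r : Config) : act elemR (hatConfig d r) =
    hatConfig ((Equiv.swap Corner.a Corner.c * Equiv.swap Corner.b Corner.c) d) (act elemR r) :=
  isHat_iff.1 (act_elemR_isHat (isHat_hatConfig r d))

theorem act_elemI_basePoint : act elemI basePoint = shift (1, 0) basePoint := by
  funext ⟨x, y⟩
  rw [act_elemI, shift_apply, Prod.mk_add_mk, add_zero]
  rcases lt_or_ge 0 y with hy | hy
  · rw [basePoint_of_pos hy, basePoint_of_pos hy]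
  rcases le_or_gt (-x - y) 0 with h | h
  · rw [basePoint_of_nonpos x.toNat (x + y).toNat hy h (by omega) (by omega),
      basePoint_of_one_le x.toNat (x + y).toNat hy (by omega) (by omega)]
  · rcases lt_or_ge x 0 with hx | hx
    · rw [basePoint_of_one_le (-x - y - 1).toNat (-x - 1).toNat hy (by omega) (by omega),
        basePoint_of_nonpos (-x - y - 1).toNat (-x - 1).toNat hy (by omega) (by omega) (by omega)]
    · rw [basePoint_of_add_nonpos h (by omega), basePoint_of_add_nonpos (by omega) (by omega)]

/-- `r p₀` is the fixed point of `p ↦ p̂^c` which agrees with `S⁻¹p₀ ∈ Γ` near the origin; hence it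
is the limit of the iterated images of `S⁻¹p₀`. -/
theorem act_elemR_basePoint_mem_closure : act elemR basePoint ∈ closure pascal := by
  set q := act elemR basePoint with hq
  set q' := shift (0, -1) basePoint with hq'
  have hfix : hatConfig Corner.c q = q := by
    conv_rhs => rw [hq, ← basePoint_eq_hatConfig, act_elemR_hatConfig]
    rfl
  have hmem : ∀ n : ℕ, (hatConfig Corner.c)^[n] q' ∈ pascal := by
    intro n
    induction n with
    | zero =>
      refine shift_basePoint_mem_pascal ?_
      rw [basePoint_of_nonpos 1 0 (by omega) (by omega) (by omega) (by omega)]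
      decide
    | succ n ih => rw [Function.iterate_succ_apply']; exact hatConfig_mem_pascal ih _
  have hagree : ∀ n : ℕ, ∀ x y : ℤ, -2 ^ n + 1 ≤ x → x ≤ 2 ^ n → -2 ^ n ≤ y → y ≤ 2 ^ n - 1 →
      (hatConfig Corner.c)^[n] q' (x, y) = q (x, y) := by
    intro n
    induction n with
    | zero =>
      intro x y h1 h2 h3 h4
      rw [pow_zero] at h1 h2 h3 h4
      rw [Function.iterate_zero_apply, hq, hq', act_elemR, shift_apply, Prod.mk_add_mk, add_zero]
      obtain rfl | rfl : x = 0 ∨ x = 1 := by omega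
      all_goals obtain rfl | rfl : y = 0 ∨ y = -1 := by omega
      all_goals decide
    | succ n ih =>
      intro x y h1 h2 h3 h4
      rw [pow_succ] at h1 h2 h3 h4
      rw [Function.iterate_succ_apply', ← hfix]
      change double _ (x + 0, y + -1) = double _ (x + 0, y + -1)
      by_cases h : (x + 0) % 2 = 1 ∧ (y + -1) % 2 = 1
      · rw [double_eq_zero _ h.1 h.2, double_eq_zero _ h.1 h.2]
      · rw [double_eq _ _ _ (by omega) rfl rfl, double_eq _ _ _ (by omega) rfl rfl]
        generalize (2 : ℤ) ^ n = N at *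
        exact ih _ _ (by omega) (by omega) (by omega) (by omega)
  refine mem_closure_of_tendsto (f := fun n => (hatConfig Corner.c)^[n] q') (b := Filter.atTop)
    (tendsto_pi_nhds.2 ?_) (Filter.Eventually.of_forall hmem)
  rintro ⟨x, y⟩
  refine tendsto_const_nhds.congr' ?_
  filter_upwards [Filter.eventually_ge_atTop (x.natAbs + y.natAbs + 1)] with n hn
  have : (n : ℤ) < 2 ^ n := by exact_mod_cast Nat.lt_two_pow_self
  exact (hagree n x y (by omega) (by omega) (by omega) (by omega)).symm

theorem act_elemI_mem_closure {p : Config} (hp : p ∈ closure pascal) (h0 : p (0, 0) = 1) :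
    act elemI p ∈ closure pascal := by
  refine map_mem_closure_pascal (continuous_act _) (v := (0, 0)) ?_ hp (by rwa [act_zero])
  rintro _ ⟨-, u, rfl⟩ hq
  rw [act_elemI_shift, act_elemI_basePoint] at hq ⊢
  rw [shift_shift] at hq ⊢
  exact subset_closure (shift_basePoint_mem_pascal
    (by rwa [shift_apply, Prod.mk_zero_zero, zero_add] at hq))

theorem act_elemR_mem_closure {p : Config} (hp : p ∈ closure pascal) (h0 : p (0, 0) = 1) :
    act elemR p ∈ closure pascal := by
  refine map_mem_closure_pascal (continuous_act _) (v := (0, 0)) ?_ hp (by rwa [act_zero])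
  rintro _ ⟨-, u, rfl⟩ hq
  rw [act_elemR_shift] at hq ⊢
  exact shift_mem_closure act_elemR_basePoint_mem_closure
    (by rwa [shift_apply, Prod.mk_zero_zero, zero_add] at hq)

theorem permMod2_mul (s t : GL (Fin 2) ℤ) : permMod2 (s * t) = permMod2 s * permMod2 t := by
  ext1 x
  simp only [permMod2, map_mul]
  rfl

theorem permMod2_apply (s : GL (Fin 2) ℤ) (v : Fin 2 → ZMod 2) :
    permMod2 s v = (s.val.map (Int.castRingHom (ZMod 2))).mulVec v := rfl

theorem signature_mul (s t : GL (Fin 2) ℤ) : signature (s * t) = signature s * signature t := by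
  rw [signature, permMod2_mul, map_mul]; rfl

theorem signature_one : signature 1 = 1 := by
  have h := signature_mul 1 1
  rw [mul_one] at h
  exact left_eq_mul.1 h

theorem signature_elemI : signature elemI = -1 := by
  have : permMod2 elemI = Equiv.swap ![1, 1] ![0, 1] := by
    ext1 v
    rw [permMod2_apply]
    revert v
    decide
  rw [signature, this]
  exact Equiv.Perm.sign_swap (by decide)

theorem signature_elemR : signature elemR = 1 := by
  have h3 : elemR * elemR * elemR = 1 := by rw [← elemR_inv, inv_mul_cancel]
  have h := congrArg signature h3
  rw [signature_mul, signature_mul, Int.units_mul_self, one_mul, signature_one] at h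
  exact h

/-- `s` preserves `Γ̄` and permutes the labels by `σ`, whose signature is `ε(s)`. -/
def ActsBy (s : GL (Fin 2) ℤ) (σ : Equiv.Perm Corner) : Prop :=
  (∀ p ∈ pascalBar, act s p ∈ pascalBar) ∧ signature s = Equiv.Perm.sign σ ∧
    ∀ d r, act s (hatConfig d r) = hatConfig (σ d) (act s r)

theorem ActsBy.mul {s t : GL (Fin 2) ℤ} {σ τ : Equiv.Perm Corner} (hs : ActsBy s σ)
    (ht : ActsBy t τ) : ActsBy (s * t) (σ * τ) := by
  refine ⟨fun p hp => by rw [act_mul]; exact hs.1 _ (ht.1 _ hp), ?_, fun d r => ?_⟩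
  · rw [signature_mul, hs.2.1, ht.2.1, map_mul]
  · rw [act_mul, ht.2.2, hs.2.2, act_mul]; rfl

theorem actsBy_elemI : ActsBy elemI (Equiv.swap Corner.a Corner.b) := by
  refine ⟨fun p hp => ?_, ?_, act_elemI_hatConfig⟩
  · obtain ⟨h1, h2⟩ := mem_pascalBar_iff.1 hp
    exact mem_pascalBar_iff.2 ⟨act_elemI_mem_closure h1 h2, by rwa [act_zero]⟩
  · rw [signature_elemI, Equiv.Perm.sign_swap (by decide)]

theorem actsBy_elemR :
    ActsBy elemR (Equiv.swap Corner.a Corner.c * Equiv.swap Corner.b Corner.c) := by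
  refine ⟨fun p hp => ?_, ?_, act_elemR_hatConfig⟩
  · obtain ⟨h1, h2⟩ := mem_pascalBar_iff.1 hp
    exact mem_pascalBar_iff.2 ⟨act_elemR_mem_closure h1 h2, by rwa [act_zero]⟩
  · rw [signature_elemR, map_mul, Equiv.Perm.sign_swap (by decide),
      Equiv.Perm.sign_swap (by decide)]
    rfl

theorem exists_actsBy {s : GL (Fin 2) ℤ} (hs : s ∈ symGroup) : ∃ σ, ActsBy s σ := by
  -- the inverses of the generators are words in the generators
  have hclos : symGroup.toSubmonoid = Submonoid.closure {elemI, elemR} := by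
    rw [symGroup, Subgroup.closure_toSubmonoid]
    refine le_antisymm (Submonoid.closure_le.2 ?_) (Submonoid.closure_mono Set.subset_union_left)
    have h1 : elemI ∈ Submonoid.closure {elemI, elemR} :=
      Submonoid.subset_closure (Set.mem_insert _ _)
    have h2 : elemR ∈ Submonoid.closure {elemI, elemR} :=
      Submonoid.subset_closure (Set.mem_insert_of_mem _ rfl)
    rintro x (hx | hx)
    · exact Submonoid.subset_closure hx
    · rw [Set.mem_inv] at hx
      rcases hx with hx | hx
      · rw [← inv_inv x, hx, elemI_inv]; exact h1
      · rw [← inv_inv x, hx, elemR_inv]; exact mul_mem h2 h2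
  have hs' : s ∈ Submonoid.closure {elemI, elemR} := hclos ▸ hs
  clear hs
  induction hs' using Submonoid.closure_induction with
  | mem x hx =>
    rcases hx with rfl | rfl
    exacts [⟨_, actsBy_elemI⟩, ⟨_, actsBy_elemR⟩]
  | one =>
    refine ⟨1, fun p hp => by rwa [act_one], by rw [signature_one, map_one], fun d r => ?_⟩
    rw [act_one, act_one]; rfl
  | mul x y _ _ hx hy =>
    obtain ⟨σ, hσ⟩ := hx
    obtain ⟨τ, hτ⟩ := hy
    exact ⟨σ * τ, hσ.mul hτ⟩

/-! ### Words and the abstract triangles -/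

/-- Words of length `n` in the letters `a, b, c`. -/
def Word : ℕ → Type
  | 0 => Unit
  | n + 1 => Corner × Word n

instance Word.instFintype : (n : ℕ) → Fintype (Word n)
  | 0 => inferInstanceAs (Fintype Unit)
  | n + 1 => letI := Word.instFintype n; inferInstanceAs (Fintype (Corner × Word n))

instance Word.instDecidableEq : (n : ℕ) → DecidableEq (Word n)
  | 0 => inferInstanceAs (DecidableEq Unit)
  | n + 1 => letI := Word.instDecidableEq n; inferInstanceAs (DecidableEq (Corner × Word n))

/-- The constant word `d ⋯ d`. -/
def diag (d : Corner) : (n : ℕ) → Word n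
  | 0 => ()
  | n + 1 => (d, diag d n)

/-- The letterwise action of a permutation of the letters. -/
def permWord (σ : Equiv.Perm Corner) : (n : ℕ) → Word n → Word n
  | 0, w => w
  | n + 1, w => (σ w.1, permWord σ n w.2)

/-- The couple `(d, w)` stands for the edge of label `d` at the point `w` of the `n`-triangle, and
`tau n` reverses this edge. The edges `(d, d ⋯ d)`, which leave the `n`-triangle, are fixed. -/
def tau : (n : ℕ) → Corner × Word n → Corner × Word n
  | 0, x => x
  | n + 1, (e, (f, w)) =>
    if e = f then ((tau n (e, w)).1, ((tau n (e, w)).1, (tau n (e, w)).2)) else (f, (e, w))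

theorem tau_self {n : ℕ} (d : Corner) (w : Word n) :
    tau (n + 1) (d, (d, w)) = ((tau n (d, w)).1, tau n (d, w)) := if_pos rfl

theorem tau_of_ne {n : ℕ} {d e : Corner} (h : d ≠ e) (w : Word n) :
    tau (n + 1) (d, (e, w)) = (e, (d, w)) := if_neg h

theorem tau_tau : ∀ {n : ℕ} (x : Corner × Word n), tau n (tau n x) = x
  | 0, _ => rfl
  | n + 1, (e, (f, w)) => by
    by_cases h : e = f
    · subst h
      refine (congrArg (tau (n + 1)) (tau_self e w)).trans ((tau_self _ _).trans ?_)
      rw [Prod.mk.eta, tau_tau]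
      rfl
    · exact (congrArg (tau (n + 1)) (tau_of_ne h w)).trans (tau_of_ne (Ne.symm h) w)

theorem tau_eq_self_of_fst : ∀ {n : ℕ} {x : Corner × Word n}, (tau n x).1 = x.1 → tau n x = x
  | 0, _, _ => rfl
  | n + 1, (e, (f, w)), hx => by
    by_cases h : e = f
    · subst h
      rw [tau_self] at hx ⊢
      rw [tau_eq_self_of_fst hx]
      rfl
    · rw [tau_of_ne h] at hx
      exact absurd hx.symm h

theorem tau_diag (d : Corner) : ∀ n : ℕ, tau n (d, diag d n) = (d, diag d n)
  | 0 => rfl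
  | n + 1 => (tau_self d _).trans (by rw [tau_diag d n]; rfl)

theorem eq_diag_of_tau_eq_self : ∀ {n : ℕ} {d : Corner} {w : Word n}, tau n (d, w) = (d, w) →
    w = diag d n
  | 0, _, _, _ => rfl
  | n + 1, e, (f, w), hx => by
    by_cases h : e = f
    · subst h
      rw [tau_self] at hx
      rw [eq_diag_of_tau_eq_self (Prod.mk.inj hx).2]
      rfl
    · rw [tau_of_ne h] at hx
      exact absurd (Prod.mk.inj hx).1.symm h

theorem tau_permWord (σ : Equiv.Perm Corner) : ∀ {n : ℕ} (d : Corner) (w : Word n),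
    tau n (σ d, permWord σ n w) = (σ (tau n (d, w)).1, permWord σ n (tau n (d, w)).2)
  | 0, _, _ => rfl
  | n + 1, e, (f, w) => by
    change tau (n + 1) (σ e, (σ f, permWord σ n w)) = _
    by_cases h : e = f
    · subst h
      rw [tau_self, tau_self, tau_permWord]
      rfl
    · rw [tau_of_ne (σ.injective.ne h), tau_of_ne h]
      rfl

theorem permWord_diag (σ : Equiv.Perm Corner) (d : Corner) :
    ∀ n : ℕ, permWord σ n (diag d n) = diag (σ d) n
  | 0 => rfl
  | n + 1 => congrArg (Prod.mk (σ d)) (permWord_diag σ d n)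

theorem permWord_mul (σ ρ : Equiv.Perm Corner) :
    ∀ {n : ℕ} (w : Word n), permWord (σ * ρ) n w = permWord σ n (permWord ρ n w)
  | 0, _ => rfl
  | _ + 1, w => congrArg (Prod.mk (σ (ρ w.1))) (permWord_mul σ ρ w.2)

theorem permWord_one : ∀ {n : ℕ} (w : Word n), permWord 1 n w = w
  | 0, _ => rfl
  | _ + 1, w => congrArg (Prod.mk w.1) (permWord_one w.2)

theorem permWord_inv_permWord (σ : Equiv.Perm Corner) {n : ℕ} (w : Word n) :
    permWord σ⁻¹ n (permWord σ n w) = w := by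
  rw [← permWord_mul, inv_mul_cancel, permWord_one]

theorem permWord_permWord_inv (σ : Equiv.Perm Corner) {n : ℕ} (w : Word n) :
    permWord σ n (permWord σ⁻¹ n w) = w := by
  rw [← permWord_mul, mul_inv_cancel, permWord_one]

/-! ### Words as addresses in `Γ̄` -/

/-- The bijection `Word n × Γ̄ ≃ Γ̄` which sends `(d₁ ⋯ dₙ, r)` to the point `p` with
`Π̄ⁿ p = r` and `θ₁(Π̄ⁱ p) = dᵢ₊₁`. -/
noncomputable def fillEquiv : (n : ℕ) → Word n × pascalBar ≃ pascalBar
  | 0 => Equiv.punitProd pascalBar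
  | n + 1 => (Equiv.prodAssoc Corner (Word n) pascalBar).trans
      (((Equiv.refl Corner).prodCongr (fillEquiv n)).trans hatEquiv)

theorem fillEquiv_succ {n : ℕ} (d : Corner) (w : Word n) (r : pascalBar) :
    fillEquiv (n + 1) ((d, w), r) = hatEquiv (d, fillEquiv n (w, r)) := rfl

theorem fillEquiv_inj {n : ℕ} {w w' : Word n} {r r' : pascalBar} :
    fillEquiv n (w, r) = fillEquiv n (w', r') ↔ w = w' ∧ r = r' := by
  rw [(fillEquiv n).apply_eq_iff_eq, Prod.mk.injEq]

/-- The word of the labels of `p, Π̄ p, …, Π̄ⁿ⁻¹ p`. -/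
noncomputable def address (n : ℕ) (p : pascalBar) : Word n := ((fillEquiv n).symm p).1

theorem address_fillEquiv {n : ℕ} (w : Word n) (r : pascalBar) :
    address n (fillEquiv n (w, r)) = w := by
  rw [address, Equiv.symm_apply_apply]

theorem exists_eq_fillEquiv (n : ℕ) (p : pascalBar) : ∃ w r, p = fillEquiv n (w, r) :=
  ⟨_, _, ((fillEquiv n).apply_symm_apply p).symm⟩

theorem isCross_fillEquiv : ∀ {n : ℕ} {d d' : Corner} {w w' : Word n} (_ : tau n (d, w) = (d', w'))
    (_ : d ≠ d') (r : pascalBar), IsCross d (fillEquiv n (w, r)) d' (fillEquiv n (w', r))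
  | 0, _, _, _, _, h, hne, _ => absurd (Prod.mk.inj h).1 hne
  | n + 1, d, d', (e, v), (e', v'), h, hne, r => by
    rw [fillEquiv_succ, fillEquiv_succ]
    by_cases hde : d = e
    · subst hde
      rw [tau_self] at h
      obtain ⟨h1, h2⟩ := Prod.mk.inj h
      have h3 : d' = e' := by rw [← h1, h2]
      subst h3
      exact (isCross_fillEquiv h2 hne r).hatEquiv
    · rw [tau_of_ne hde] at h
      obtain ⟨h1, h2⟩ := Prod.mk.inj h
      obtain ⟨h3, h4⟩ := Prod.mk.inj h2
      subst h1 h3 h4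
      exact isCross_hatEquiv_of_ne hde _

theorem IsCross.fillEquiv_diag {d d' : Corner} {r r' : pascalBar} (h : IsCross d r d' r') :
    ∀ n : ℕ, IsCross d (fillEquiv n (diag d n, r)) d' (fillEquiv n (diag d' n, r'))
  | 0 => h
  | n + 1 => (h.fillEquiv_diag n).hatEquiv

/-- The neighbour along an edge stays in the same `n`-triangle, unless the edge leaves a vertex. -/
theorem nbr_fillEquiv_cases {n : ℕ} (d : Corner) (w : Word n) (r : pascalBar) :
    ((tau n (d, w)).1 ≠ d ∧ nbr d (fillEquiv n (w, r)) = fillEquiv n ((tau n (d, w)).2, r)) ∨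
      (tau n (d, w) = (d, w) ∧ w = diag d n ∧
        nbr d (fillEquiv n (w, r)) = fillEquiv n (diag (revLabel d r) n, nbr d r)) := by
  by_cases h : (tau n (d, w)).1 = d
  · have h1 := tau_eq_self_of_fst h
    have h2 := eq_diag_of_tau_eq_self h1
    subst h2
    exact Or.inr ⟨h1, rfl, ((isCross_nbr d r).fillEquiv_diag n).nbr_eq⟩
  · exact Or.inl ⟨h, (isCross_fillEquiv (d' := (tau n (d, w)).1) rfl (Ne.symm h) r).nbr_eq⟩

/-- The graph of the `n`-triangle, with points coded by words. -/
def wordGraph (n : ℕ) : SimpleGraph (Word n) where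
  Adj w w' := w ≠ w' ∧ ∃ d, w' = (tau n (d, w)).2
  symm := ⟨by
    rintro w _ ⟨hne, d, rfl⟩
    exact ⟨hne.symm, (tau n (d, w)).1, by rw [Prod.mk.eta, tau_tau]⟩⟩
  loopless := ⟨fun _ h => h.1 rfl⟩

theorem adj_fillEquiv_iff {n : ℕ} {w w' : Word n} {r : pascalBar} :
    barGraph.Adj (fillEquiv n (w, r)) (fillEquiv n (w', r)) ↔ (wordGraph n).Adj w w' := by
  constructor
  · intro h
    refine ⟨fun h' => h.ne (by rw [h']), ?_⟩
    obtain ⟨d, hd⟩ := barGraph_adj_iff_nbr.1 h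
    rcases nbr_fillEquiv_cases d w r with ⟨-, h2⟩ | ⟨-, -, h3⟩
    · rw [h2, fillEquiv_inj] at hd
      exact ⟨d, hd.1⟩
    · rw [h3, fillEquiv_inj] at hd
      exact absurd hd.2.symm (nbr_ne d r)
  · rintro ⟨hne, d, rfl⟩
    refine barGraph_adj_iff_nbr.2 ⟨d, ?_⟩
    rcases nbr_fillEquiv_cases d w r with ⟨-, h2⟩ | ⟨h1, -, -⟩
    · exact h2.symm
    · rw [h1] at hne
      exact absurd rfl hne

/-- Distinct labels at a point give distinct neighbours. -/
theorem label_eq_of_tau_snd_eq {n : ℕ} {d d' : Corner} {w : Word n} (hd : (tau n (d, w)).1 ≠ d)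
    (hd' : (tau n (d', w)).1 ≠ d') (h : (tau n (d, w)).2 = (tau n (d', w)).2) : d = d' := by
  let r : pascalBar := ⟨basePoint, basePoint_mem_pascalBar⟩
  have h1 := isCross_fillEquiv (d' := (tau n (d, w)).1) rfl hd.symm r
  have h2 := isCross_fillEquiv (d' := (tau n (d', w)).1) rfl hd'.symm r
  rw [← h] at h2
  exact (h1.label_unique h2).1

theorem wordGraph_succ_adj {n : ℕ} {x x' : Corner × Word n} :
    (wordGraph (n + 1)).Adj x x' ↔ x ≠ x' ∧ (x.2 = x'.2 ∨ x' = tau n x) := by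
  obtain ⟨d, w⟩ := x
  refine and_congr_right fun hne => ?_
  constructor
  · rintro ⟨f, hf⟩
    by_cases h : f = d
    · subst h
      rw [tau_self] at hf
      exact Or.inr hf
    · rw [tau_of_ne h] at hf
      exact Or.inl (by rw [hf])
  · rintro (h | h)
    · obtain ⟨f, w'⟩ := x'
      obtain rfl : w = w' := h
      refine ⟨f, ?_⟩
      rw [tau_of_ne]
      rintro rfl
      exact hne rfl
    · exact ⟨d, by rw [tau_self, h]⟩

theorem diag_succ_injective {n : ℕ} {d d' : Corner} (h : diag d (n + 1) = diag d' (n + 1)) :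
    d = d' := (Prod.mk.inj h).1

/-- The words of length `n + 1` are the points of the abstract `(n + 1)`-triangle. -/
theorem exists_wordGraph_iso : ∀ n : ℕ, ∃ E : wordGraph (n + 1) ≃g (triangle (n + 1)).graph,
    ∀ d, E (diag d (n + 1)) = (triangle (n + 1)).corner d
  | 0 => by
    refine ⟨⟨Equiv.prodPUnit Corner, ?_⟩, fun d => rfl⟩
    rintro ⟨d, ⟨⟩⟩ ⟨d', ⟨⟩⟩
    rw [wordGraph_succ_adj]
    constructor
    · intro h
      exact ⟨fun h' => h (Prod.mk.inj h').1, Or.inl rfl⟩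
    · rintro ⟨h, -⟩ h'
      exact h (congrArg (fun x => (x, ())) h')
  | n + 1 => by
    obtain ⟨E, hE⟩ := exists_wordGraph_iso n
    have hadj : ∀ x : Corner × Word (n + 1), (tau (n + 1) x).1 ≠ x.1 →
        (triangle (n + 1)).graph.Adj (E x.2) (E (tau (n + 1) x).2) := by
      rintro ⟨d, w⟩ h
      rw [E.map_adj_iff]
      refine ⟨fun hw => h ?_, d, rfl⟩
      -- `w` is not its own neighbour, as is seen in `Γ̄`
      have h1 := isCross_fillEquiv (d' := (tau (n + 1) (d, w)).1) rfl (Ne.symm h)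
        ⟨basePoint, basePoint_mem_pascalBar⟩
      exact absurd (congrArg _ (congrArg (fun w => (w, _)) hw)) h1.ne
    let F : Corner × Word (n + 1) → Corner ⊕ (triangle (n + 1)).graph.Dart := fun x =>
      if h : (tau (n + 1) x).1 = x.1 then Sum.inl x.1 else Sum.inr ⟨(_, _), hadj x h⟩
    have F1 : ∀ x, (tau (n + 1) x).1 = x.1 → F x = Sum.inl x.1 := fun x h => dif_pos h
    have F2 : ∀ x (h : (tau (n + 1) x).1 ≠ x.1), F x = Sum.inr ⟨(_, _), hadj x h⟩ :=
      fun x h => dif_neg h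
    have hdiag : ∀ x : Corner × Word (n + 1), (tau (n + 1) x).1 = x.1 →
        x = (x.1, diag x.1 (n + 1)) := fun x h =>
      Prod.ext rfl (eq_diag_of_tau_eq_self (tau_eq_self_of_fst h))
    have hinj : Function.Injective F := by
      intro x x' h
      by_cases hx : (tau (n + 1) x).1 = x.1 <;> by_cases hx' : (tau (n + 1) x').1 = x'.1
      · rw [F1 x hx, F1 x' hx', Sum.inl.injEq] at h
        rw [hdiag x hx, hdiag x' hx', h]
      · rw [F1 x hx, F2 x' hx'] at h
        cases h
      · rw [F2 x hx, F1 x' hx'] at h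
        cases h
      · rw [F2 x hx, F2 x' hx', Sum.inr.injEq, SimpleGraph.Dart.mk.injEq, Prod.mk.injEq,
          E.injective.eq_iff, E.injective.eq_iff] at h
        obtain ⟨d, w⟩ := x
        obtain ⟨d', w'⟩ := x'
        obtain ⟨rfl, h2⟩ := h
        rw [label_eq_of_tau_snd_eq hx hx' h2]
    have hsurj : Function.Surjective F := by
      rintro (d | ⟨⟨v, v'⟩, hv⟩)
      · exact ⟨(d, diag d (n + 1)), F1 _ (by rw [tau_diag])⟩
      · obtain ⟨w, rfl⟩ := E.surjective v
        obtain ⟨w', rfl⟩ := E.surjective v'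
        obtain ⟨hne, d, rfl⟩ := E.map_adj_iff.1 hv
        refine ⟨(d, w), F2 _ fun h => hne ?_⟩
        rw [tau_eq_self_of_fst h]
    refine ⟨⟨Equiv.ofBijective F ⟨hinj, hsurj⟩, ?_⟩,
      fun d => F1 (d, diag d (n + 1)) (by rw [tau_diag])⟩
    intro x x'
    change Corner × Word (n + 1) at x x'
    change hatAdj _ (F x) (F x') ↔ _
    rw [wordGraph_succ_adj]
    by_cases hx : (tau (n + 1) x).1 = x.1 <;> by_cases hx' : (tau (n + 1) x').1 = x'.1
    · rw [F1 x hx, F1 x' hx']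
      refine iff_of_false id ?_
      rintro ⟨hne, h | h⟩
      · rw [hdiag x hx, hdiag x' hx'] at h
        apply hne
        rw [hdiag x hx, hdiag x' hx', diag_succ_injective h]
      · rw [tau_eq_self_of_fst hx] at h
        exact hne h.symm
    · have hne : x ≠ x' := by rintro rfl; exact hx' hx
      rw [F1 x hx, F2 x' hx']
      change E x'.2 = _ ↔ _
      rw [← hE, E.injective.eq_iff, ← eq_diag_of_tau_eq_self (tau_eq_self_of_fst hx),
        tau_eq_self_of_fst hx]
      exact ⟨fun h => ⟨hne, Or.inl h.symm⟩, fun h => h.2.elim Eq.symm fun h => absurd h.symm hne⟩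
    · have hne : x ≠ x' := by rintro rfl; exact hx hx'
      rw [F2 x hx, F1 x' hx']
      change E x.2 = _ ↔ _
      rw [← hE, E.injective.eq_iff, ← eq_diag_of_tau_eq_self (tau_eq_self_of_fst hx')]
      refine ⟨fun h => ⟨hne, Or.inl h⟩, fun h => h.2.elim id fun h => absurd ?_ hne⟩
      rw [← tau_eq_self_of_fst hx', h, tau_tau]
    · rw [F2 x hx, F2 x' hx']
      change (E x.2 = E x'.2 ∧ E _ ≠ E _) ∨ (E _ = E _ ∧ E _ = E _) ↔ _
      rw [E.injective.eq_iff, E.injective.ne_iff, E.injective.eq_iff, E.injective.eq_iff]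
      constructor
      · rintro (⟨h1, h2⟩ | ⟨h1, h2⟩)
        · exact ⟨fun h => h2 (by rw [h]), Or.inl h1⟩
        · have key : x' = tau (n + 1) x := by
            obtain ⟨d', w'⟩ := x'
            obtain rfl : _ = w' := h2
            have := label_eq_of_tau_snd_eq (d := d') (d' := (tau (n + 1) x).1)
              (w := (tau (n + 1) x).2) hx'
              (by rw [Prod.mk.eta, tau_tau]; exact Ne.symm hx)
              (by rw [Prod.mk.eta, tau_tau]; exact h1.symm)
            rw [this]
          exact ⟨fun h => hx (by rw [← key, h]), Or.inr key⟩
      · rintro ⟨hne, h | h⟩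
        · refine Or.inl ⟨h, fun h' => hne (hinj ?_)⟩
          rw [F2 x hx, F2 x' hx', Sum.inr.injEq, SimpleGraph.Dart.mk.injEq, Prod.mk.injEq, h, h']
          exact ⟨rfl, rfl⟩
        · refine Or.inr ⟨?_, ?_⟩
          · rw [h, tau_tau]
          · rw [h]

/-! ### The triangles of `Γ̄` and the coding map -/

theorem exists_ne_ne (d e : Corner) : ∃ f : Corner, f ≠ d ∧ f ≠ e := by
  revert d e; decide

/-- The only edge of `Γ̄` out of `r̂^d` which leaves the triangle above `r` is the edge of label
`d`. -/
theorem barGraph_adj_cases {d d' : Corner} {r r' : pascalBar}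
    (h : barGraph.Adj (hatEquiv (d, r)) (hatEquiv (d', r'))) :
    r = r' ∨ (d' = revLabel d r ∧ r' = nbr d r) := by
  obtain ⟨e, he⟩ := barGraph_adj_iff_nbr.1 h
  by_cases hed : e = d
  · subst hed
    rw [nbr_hatEquiv_self, hatEquiv_inj] at he
    exact Or.inr he
  · rw [nbr_hatEquiv_of_ne hed, hatEquiv_inj] at he
    exact Or.inl he.2.symm

theorem eq_of_clique {d₁ d₂ d₃ : Corner} {r₁ r₂ r₃ : pascalBar}
    (h₁₂ : barGraph.Adj (hatEquiv (d₁, r₁)) (hatEquiv (d₂, r₂)))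
    (h₁₃ : barGraph.Adj (hatEquiv (d₁, r₁)) (hatEquiv (d₃, r₃)))
    (h₂₃ : barGraph.Adj (hatEquiv (d₂, r₂)) (hatEquiv (d₃, r₃))) : r₁ = r₂ := by
  by_contra hne
  have e₁ := (barGraph_adj_cases h₁₂).resolve_left hne
  have e₂ := (barGraph_adj_cases h₁₂.symm).resolve_left (Ne.symm hne)
  rcases barGraph_adj_cases h₁₃ with rfl | h
  · rcases barGraph_adj_cases h₂₃ with rfl | h
    · exact hne rfl
    · exact h₁₃.ne (by rw [e₂.1, h.1])
  · exact h₂₃.ne (by rw [h.1, h.2, ← e₁.1, ← e₁.2])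

theorem exists_perm_of_injective {f : Corner → Corner} (hf : Function.Injective f) :
    ∃ σ : Equiv.Perm Corner, ∀ d, σ d = f d :=
  ⟨Equiv.ofBijective f (Finite.injective_iff_bijective.1 hf), fun _ => rfl⟩

/-- An embedding of the `(n + 1)`-triangle sends the triangles of points `(d, u)`, `u` fixed, to
fibres of `Π̄`. -/
theorem exists_contract_embedding {n : ℕ} {φ : Corner × Word n → pascalBar}
    (hinj : Function.Injective φ)
    (hadj : ∀ u u', (wordGraph (n + 1)).Adj u u' → barGraph.Adj (φ u) (φ u')) :
    ∃ (φ' : Word n → pascalBar) (ρ : Word n → Equiv.Perm Corner),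
      ∀ d u, φ (d, u) = hatEquiv (ρ u d, φ' u) := by
  have hA : ∀ d e u, d ≠ e → barGraph.Adj (φ (d, u)) (φ (e, u)) := fun d e u h =>
    hadj _ _ (wordGraph_succ_adj.2 ⟨fun h' => h (Prod.mk.inj h').1, Or.inl rfl⟩)
  choose l r hlr using fun x => exists_eq_hatEquiv (φ x)
  have hr : ∀ d e u, d ≠ e → r (d, u) = r (e, u) := by
    intro d e u h
    obtain ⟨f, hfd, hfe⟩ := exists_ne_ne d e
    have h1 := hA d e u h
    have h2 := hA d f u hfd.symm
    have h3 := hA e f u hfe.symm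
    rw [hlr, hlr (e, u)] at h1
    rw [hlr, hlr (f, u)] at h2
    rw [hlr, hlr (f, u)] at h3
    exact eq_of_clique h1 h2 h3
  have hr' : ∀ d u, r (d, u) = r (Corner.a, u) := by
    intro d u
    by_cases h : d = Corner.a
    · rw [h]
    · exact hr _ _ _ h
  have hl : ∀ u, Function.Injective fun d => l (d, u) := by
    intro u d e h
    have : φ (d, u) = φ (e, u) := by rw [hlr, hlr (e, u), hr', hr' e]; simp only at h; rw [h]
    exact (Prod.mk.inj (hinj this)).1
  choose ρ hρ using fun u => exists_perm_of_injective (hl u)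
  exact ⟨fun u => r (Corner.a, u), ρ, fun d u => by rw [hlr, hr', hρ]⟩

/-- The `(n + 1)`-triangles of `Γ̄` are the fibres of `Π̄ⁿ⁺¹`, and their parametrizations by words
are unique up to a permutation of the letters. -/
theorem exists_eq_fillEquiv_of_embedding : ∀ (n : ℕ) (φ : Word (n + 1) → pascalBar)
    (_ : Function.Injective φ)
    (_ : ∀ u u', barGraph.Adj (φ u) (φ u') ↔ (wordGraph (n + 1)).Adj u u'),
    ∃ (σ : Equiv.Perm Corner) (r : pascalBar),
      ∀ u, φ u = fillEquiv (n + 1) (permWord σ (n + 1) u, r) := by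
  intro n
  induction n with
  | zero =>
    intro φ hinj hadj
    obtain ⟨φ', ρ, h⟩ := exists_contract_embedding hinj fun u u' => (hadj u u').2
    exact ⟨ρ (), φ' (), fun u => h u.1 ()⟩
  | succ n ih =>
    intro φ hinj hadj
    obtain ⟨φ', ρ, h⟩ := exists_contract_embedding hinj fun u u' => (hadj u u').2
    have hinj' : Function.Injective φ' := by
      intro u u' huu
      have h1 : φ (Corner.a, u) = φ ((ρ u').symm (ρ u Corner.a), u') := by
        rw [h, h, huu, Equiv.apply_symm_apply]
      exact (Prod.mk.inj (hinj h1)).2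
    have hcross : ∀ d u, (tau (n + 1) (d, u)).1 ≠ d →
        φ' (tau (n + 1) (d, u)).2 = nbr (ρ u d) (φ' u) ∧ u ≠ (tau (n + 1) (d, u)).2 := by
      intro d u hd
      have hu : u ≠ (tau (n + 1) (d, u)).2 := by
        intro hu
        have h1 := isCross_fillEquiv (d' := (tau (n + 1) (d, u)).1) rfl hd.symm (φ' u)
        exact h1.ne (by rw [← hu])
      have h1 := (hadj (d, u) (tau (n + 1) (d, u))).2
        (wordGraph_succ_adj.2 ⟨fun h' => hd (by rw [← h']), Or.inr rfl⟩)
      rw [h, ← Prod.mk.eta (p := tau (n + 1) (d, u)), h] at h1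
      exact ⟨((barGraph_adj_cases h1).resolve_left fun h' => hu (hinj' h')).2, hu⟩
    obtain ⟨σ, r, hσ⟩ := ih φ' hinj' (by
      intro u u'
      constructor
      · intro hA
        refine ⟨fun h' => hA.ne (by rw [h']), ?_⟩
        obtain ⟨d, hd⟩ := barGraph_adj_iff_nbr.1 hA
        refine ⟨(ρ u).symm d, ?_⟩
        have h1 : barGraph.Adj (φ ((ρ u).symm d, u))
            (φ ((ρ u').symm (revLabel d (φ' u)), u')) := by
          rw [h, h, Equiv.apply_symm_apply, Equiv.apply_symm_apply, barGraph_adj_iff_nbr]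
          exact ⟨d, by rw [nbr_hatEquiv_self, hd]⟩
        rcases (wordGraph_succ_adj.1 ((hadj _ _).1 h1)).2 with h2 | h2
        · exact absurd hA (by rw [show u = u' from h2]; exact barGraph.loopless.1 _)
        · exact (congrArg Prod.snd h2 :)
      · rintro ⟨hne, d, rfl⟩
        have hd : (tau (n + 1) (d, u)).1 ≠ d := fun h' =>
          hne (by rw [tau_eq_self_of_fst h'])
        exact barGraph_adj_iff_nbr.2 ⟨_, (hcross d u hd).1⟩)
    have hagree : ∀ d u, (tau (n + 1) (d, u)).1 ≠ d → ρ u d = σ d := by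
      intro d u hd
      apply nbr_injective (φ' u)
      simp only
      rw [← (hcross d u hd).1, hσ, hσ]
      refine (IsCross.nbr_eq (isCross_fillEquiv (d' := σ (tau (n + 1) (d, u)).1) ?_
        (σ.injective.ne hd.symm) r)).symm
      rw [tau_permWord]
    -- at a vertex `d ⋯ d` the labels other than `d` determine the permutation
    have hall : ∀ u d, ρ u d = σ d := by
      intro u d
      by_cases hd : (tau (n + 1) (d, u)).1 = d
      · have hu := eq_diag_of_tau_eq_self (tau_eq_self_of_fst hd)
        have hne : ∀ e, e ≠ d → ρ u e = σ e := by
          intro e he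
          refine hagree e u fun h' => he ?_
          have hu' := eq_diag_of_tau_eq_self (tau_eq_self_of_fst h')
          exact diag_succ_injective (hu'.symm.trans hu)
        by_contra hcon
        have h1 : σ.symm (ρ u d) ≠ d := fun h' => hcon ((Equiv.symm_apply_eq _).1 h')
        have h2 := hne _ h1
        rw [Equiv.apply_symm_apply] at h2
        exact h1 ((ρ u).injective h2)
      · exact hagree d u hd
    refine ⟨σ, r, fun u => ?_⟩
    obtain ⟨d, u⟩ := u
    change _ = hatEquiv (σ d, fillEquiv (n + 1) (permWord σ (n + 1) u, r))
    rw [← hσ, ← hall u]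
    exact h d u

theorem contract_iterate_fillEquiv_diag (d : Corner) (r : pascalBar) :
    ∀ n : ℕ, contract^[n] (fillEquiv (n + 1) (diag d (n + 1), r)).1 = hatConfig d r.1
  | 0 => rfl
  | n + 1 => by
    rw [Function.iterate_succ_apply]
    exact (congrArg contract^[n] (contract_hatConfig _ _)).trans
      (contract_iterate_fillEquiv_diag d r n)

/-- The map `θₙ₊₁` is the address, up to the identification of the words with the points of the
abstract triangle. -/
theorem exists_coding_eq (n : ℕ) : ∃ E : Word (n + 1) ≃ (triangle (n + 1)).V,
    ∀ p, coding (n + 1) p = E (address (n + 1) p) := by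
  obtain ⟨E, hE⟩ := exists_wordGraph_iso n
  have hex : IsCoding (n + 1) fun p => E (address (n + 1) p) := by
    rintro S ⟨g⟩
    have hφ : ∀ u u', barGraph.Adj (g.symm (E u)).1 (g.symm (E u')).1 ↔
        (wordGraph (n + 1)).Adj u u' := by
      intro u u'
      rw [← E.map_adj_iff, ← g.symm.map_adj_iff]
      rfl
    obtain ⟨σ, r, h⟩ := exists_eq_fillEquiv_of_embedding n (fun u => (g.symm (E u)).1)
      (fun u u' h => E.injective (g.symm.injective (Subtype.ext h))) hφ
    have hS : ∀ p, p ∈ S ↔ ∃ w, p = fillEquiv (n + 1) (w, r) := by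
      intro p
      constructor
      · intro hp
        refine ⟨permWord σ (n + 1) (E.symm (g ⟨p, hp⟩)), ?_⟩
        rw [← h, RelIso.apply_symm_apply, RelIso.symm_apply_apply]
      · rintro ⟨w, rfl⟩
        have := h (permWord σ⁻¹ (n + 1) w)
        rw [permWord_permWord_inv] at this
        rw [← this]
        exact (g.symm _).2
    refine ⟨⟨fun _ _ => Set.mem_univ _, ?_, ?_⟩, ?_, ?_⟩
    · intro p hp q hq hpq
      obtain ⟨w, rfl⟩ := (hS p).1 hp
      obtain ⟨w', rfl⟩ := (hS q).1 hq
      have := E.injective hpq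
      rw [address_fillEquiv, address_fillEquiv] at this
      rw [this]
    · intro t _
      refine ⟨fillEquiv (n + 1) (E.symm t, r), (hS _).2 ⟨_, rfl⟩, ?_⟩
      simp only
      rw [address_fillEquiv, RelIso.apply_symm_apply]
    · intro p hp q hq
      obtain ⟨w, rfl⟩ := (hS p).1 hp
      obtain ⟨w', rfl⟩ := (hS q).1 hq
      rw [adj_fillEquiv_iff, E.map_adj_iff, address_fillEquiv, address_fillEquiv]
    · intro _ p _ d hd
      obtain ⟨w, s, rfl⟩ := exists_eq_fillEquiv (n + 1) p
      rw [← hE, E.injective.eq_iff, address_fillEquiv] at hd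
      rw [hd, Nat.add_sub_cancel, contract_iterate_fillEquiv_diag]
      exact ⟨s.1, s.2.1, isHat_iff.2 rfl⟩
  have hspec : IsCoding (n + 1) (coding (n + 1)) := Classical.epsilon_spec ⟨_, hex⟩
  refine ⟨E.toEquiv, fun p => ?_⟩
  obtain ⟨w, r, rfl⟩ := exists_eq_fillEquiv (n + 1) p
  set S : Set pascalBar := Set.range fun u : Word (n + 1) => fillEquiv (n + 1) (u, r) with hS
  have hT : IsTriangle (n + 1) S := by
    have hinj : Function.Injective fun u : Word (n + 1) => fillEquiv (n + 1) (u, r) :=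
      fun u u' h => (fillEquiv_inj.1 h).1
    refine ⟨RelIso.trans (RelIso.symm (⟨Equiv.ofInjective _ hinj, ?_⟩ :
      wordGraph (n + 1) ≃g barGraph.induce S)) E⟩
    exact adj_fillEquiv_iff
  obtain ⟨hbij, hadj, hlab⟩ := hspec S hT
  choose φ hφS hφ using fun u => hbij.surjOn (Set.mem_univ (E u))
  obtain ⟨σ, r', h⟩ := exists_eq_fillEquiv_of_embedding n φ
    (fun u u' h => E.injective (by rw [← hφ, ← hφ, h]))
    (fun u u' => by rw [hadj _ (hφS u) _ (hφS u'), hφ, hφ, E.map_adj_iff])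
  have hr : r' = r := by
    obtain ⟨v, hv⟩ := hφS w
    rw [h, fillEquiv_inj] at hv
    exact hv.2.symm
  subst hr
  have hσ : σ = 1 := by
    ext1 d
    have h1 := hlab (by omega) _ (hφS (diag d (n + 1))) d (by rw [hφ, hE])
    rw [h, permWord_diag, Nat.add_sub_cancel, contract_iterate_fillEquiv_diag] at h1
    obtain ⟨s, hs, h2⟩ := h1
    exact label_injective r'.2.1.2 (isHat_iff.1 h2)
  subst hσ
  rw [address_fillEquiv]
  change _ = E w
  rw [← hφ, h, permWord_one]

theorem triangular_succ (n : ℕ) :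
    triangular (n + 1) = LinearMap.range (LinearMap.funLeft ℂ ℂ (address (n + 1))) := by
  obtain ⟨E, hE⟩ := exists_coding_eq n
  ext φ
  constructor
  · rintro ⟨ψ, rfl⟩
    exact ⟨ψ ∘ E, funext fun p => congrArg ψ (hE p).symm⟩
  · rintro ⟨ψ, rfl⟩
    refine ⟨ψ ∘ E.symm, funext fun p => congrArg ψ ?_⟩
    rw [hE, Equiv.symm_apply_apply]

/-- The action of `𝔖` on addresses is letterwise. -/
theorem ActsBy.address {s : GL (Fin 2) ℤ} {σ : Equiv.Perm Corner} (h : ActsBy s σ) {p q : pascalBar}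
    (hq : q.1 = act s p.1) : ∀ n, address n q = permWord σ n (address n p) := by
  have key : ∀ (n : ℕ) (w : Word n) (r r' : pascalBar), r'.1 = act s r.1 →
      (fillEquiv n (permWord σ n w, r')).1 = act s (fillEquiv n (w, r)).1 := by
    intro n
    induction n with
    | zero => exact fun _ _ _ h => h
    | succ n ih =>
      intro w r r' hr
      change hatConfig (σ w.1) (fillEquiv n (permWord σ n w.2, r')).1 =
        act s (hatConfig w.1 (fillEquiv n (w.2, r)).1)
      rw [h.2.2, ih _ _ _ hr]
  intro n
  obtain ⟨w, r, rfl⟩ := exists_eq_fillEquiv n p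
  have : q = fillEquiv n (permWord σ n w, ⟨act s r.1, h.1 _ r.2⟩) :=
    Subtype.ext (hq.trans (key n w r _ rfl).symm)
  rw [this, address_fillEquiv, address_fillEquiv]

/-! ### Two facts on characteristic polynomials -/

section LinearAlgebra

variable {E F : Type*} [AddCommGroup E] [Module ℂ E] [FiniteDimensional ℂ E]
  [AddCommGroup F] [Module ℂ F] [FiniteDimensional ℂ F]

theorem det_one_sub_comp_comm (U : F →ₗ[ℂ] E) (D : E →ₗ[ℂ] F) :
    LinearMap.det (1 - U ∘ₗ D) = LinearMap.det (1 - D ∘ₗ U) := by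
  let b := Module.finBasis ℂ E
  let c := Module.finBasis ℂ F
  rw [← LinearMap.det_toMatrix b, ← LinearMap.det_toMatrix c, map_sub, map_sub,
    LinearMap.toMatrix_comp b c b, LinearMap.toMatrix_comp c b c, LinearMap.toMatrix_one,
    LinearMap.toMatrix_one, Matrix.det_one_sub_mul_comm]

/-- The effect on characteristic polynomials of replacing each point of a cubic graph by a triangle:
`U` pulls functions back, `D` sums over the triangles, and `T` exchanges the ends of the edges
which join different triangles. The adjacency operators are `D T U` below and `U D - 1 + T`
above. -/
theorem charpoly_mul_pow_finrank (U : F →ₗ[ℂ] E) (D : E →ₗ[ℂ] F) (T : E →ₗ[ℂ] E)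
    (hDU : D ∘ₗ U = (3 : ℂ) • 1) (hT : T ∘ₗ T = 1) :
    (U ∘ₗ D - 1 + T).charpoly * (X * (X + 2)) ^ Module.finrank ℂ F =
      T.charpoly.comp (X + 1) * (D ∘ₗ T ∘ₗ U).charpoly.comp (X ^ 2 - X - 3) := by
  refine eq_of_infinite_eval_eq _ _ (Set.Infinite.mono (s := ({0, -2} : Set ℂ)ᶜ) ?_
    (Set.Finite.infinite_compl (Set.toFinite _)))
  intro x hx
  simp only [Set.mem_compl_iff, Set.mem_insert_iff, Set.mem_singleton_iff, not_or] at hx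
  have hy : x * (x + 2) ≠ 0 := mul_ne_zero hx.1 fun h => hx.2 (eq_neg_of_add_eq_zero_left h)
  simp only [Set.mem_ofPred_eq, eval_mul, eval_pow, eval_comp, eval_add, eval_sub, eval_X,
    eval_one, eval_ofNat, LinearMap.eval_charpoly, Algebra.algebraMap_eq_smul_one]
  set y := x * (x + 2) with hydef
  set A : E →ₗ[ℂ] E := (x + 1) • 1 - T with hA
  set B : E →ₗ[ℂ] E := (x + 1) • 1 + T with hB
  have hT' : ∀ v, T (T v) = v := fun v => LinearMap.congr_fun hT v
  have hDU' : ∀ v, D (U v) = (3 : ℂ) • v := fun v => LinearMap.congr_fun hDU v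
  have hAB : ∀ v, A (B v) = y • v := by
    intro v
    simp only [hA, hB, LinearMap.sub_apply, LinearMap.add_apply, LinearMap.smul_apply,
      Module.End.one_apply, map_add, map_smul, hT', hydef]
    module
  have h1 : x • (1 : E →ₗ[ℂ] E) - (U ∘ₗ D - 1 + T) = A * (1 - (y⁻¹ • (B ∘ₗ U)) ∘ₗ D) := by
    ext v
    have := hAB (U (D v))
    simp only [LinearMap.sub_apply, LinearMap.add_apply, LinearMap.smul_apply, Module.End.mul_apply,
      Module.End.one_apply, map_sub, map_smul, LinearMap.comp_apply, this, smul_smul,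
      inv_mul_cancel₀ hy, one_smul]
    simp only [hA, LinearMap.sub_apply, LinearMap.smul_apply, Module.End.one_apply]
    module
  have h2 : 1 - D ∘ₗ (y⁻¹ • (B ∘ₗ U)) =
      y⁻¹ • ((x ^ 2 - x - 3) • (1 : F →ₗ[ℂ] F) - D ∘ₗ T ∘ₗ U) := by
    ext v
    have h3 : v = y⁻¹ • y • v := by rw [smul_smul, inv_mul_cancel₀ hy, one_smul]
    simp only [LinearMap.sub_apply, LinearMap.smul_apply, Module.End.one_apply,
      LinearMap.comp_apply, map_smul, hB, LinearMap.add_apply, map_add, hDU']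
    refine (congrArg (· - _) h3).trans ?_
    rw [← smul_sub, hydef]
    congr 1
    module
  rw [h1, map_mul, det_one_sub_comp_comm, h2, LinearMap.det_smul]
  have h4 : y⁻¹ ^ Module.finrank ℂ F * y ^ Module.finrank ℂ F = 1 := by
    rw [← mul_pow, inv_mul_cancel₀ hy, one_pow]
  linear_combination (LinearMap.det A * LinearMap.det
    ((x ^ 2 - x - 3) • (1 : F →ₗ[ℂ] F) - D ∘ₗ T ∘ₗ U)) * h4

theorem exists_charpoly_of_involution (T : E →ₗ[ℂ] E) (hT : T ∘ₗ T = 1) :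
    ∃ k l : ℕ, k + l = Module.finrank ℂ E ∧ (k : ℂ) - l = LinearMap.trace ℂ E T ∧
      T.charpoly = (X - 1) ^ k * (X + 1) ^ l := by
  have hs : T.charpoly.Splits := IsAlgClosed.splits _
  have hroot : ∀ x ∈ T.charpoly.roots, x = 1 ∨ x = -1 := by
    intro x hx
    have h := (Module.End.hasEigenvalue_iff_isRoot_charpoly T x).2 (isRoot_of_mem_roots hx)
    obtain ⟨v, hv⟩ := h.exists_hasEigenvector
    have h1 := hv.apply_eq_smul
    have h2 := LinearMap.congr_fun hT v
    rw [LinearMap.comp_apply, h1, map_smul, h1, smul_smul, Module.End.one_apply] at h2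
    have h3 : (x * x - 1) • v = 0 := by rw [sub_smul, h2, one_smul, sub_self]
    have h4 := (smul_eq_zero.1 h3).resolve_right hv.2
    exact mul_self_eq_one_iff.1 (sub_eq_zero.1 h4)
  have hrep : T.charpoly.roots = Multiset.replicate (T.charpoly.roots.count 1) 1 +
      Multiset.replicate (T.charpoly.roots.count (-1)) (-1) := by
    rw [← Multiset.filter_eq', ← Multiset.filter_eq']
    conv_lhs => rw [← Multiset.filter_add_not (fun x => x = 1) T.charpoly.roots]
    congr 1
    refine Multiset.filter_congr fun x hx => ⟨(hroot x hx).resolve_left, ?_⟩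
    rintro rfl
    norm_num
  refine ⟨T.charpoly.roots.count 1, T.charpoly.roots.count (-1), ?_, ?_, ?_⟩
  · rw [← LinearMap.charpoly_natDegree T, hs.natDegree_eq_card_roots]
    conv_rhs => rw [hrep]
    rw [Multiset.card_add, Multiset.card_replicate, Multiset.card_replicate]
  · let b := Module.finBasis ℂ E
    rw [LinearMap.trace_eq_matrix_trace ℂ b, Matrix.trace_eq_sum_roots_charpoly,
      LinearMap.charpoly_toMatrix]
    conv_rhs => rw [hrep]
    simp [sub_eq_add_neg]
  · conv_lhs => rw [hs.eq_prod_roots_of_monic T.charpoly_monic, hrep]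
    simp

theorem charpoly_smul_one (z : ℂ) :
    (z • (1 : E →ₗ[ℂ] E)).charpoly = (X - C z) ^ Module.finrank ℂ E := by
  refine Polynomial.funext fun x => ?_
  rw [LinearMap.eval_charpoly, Algebra.algebraMap_eq_smul_one, ← sub_smul, LinearMap.det_smul]
  simp

end LinearAlgebra

/-! ### Equivariant functions on words -/

/-- The functions on words of length `n` such that `ψ (σ w) = χ(σ) ψ(w)` for every permutation `σ`
of the letters. -/
def equivariant (χ : Equiv.Perm Corner →* ℤˣ) (n : ℕ) : Submodule ℂ (Word n → ℂ) where
  carrier := {ψ | ∀ σ w, ψ (permWord σ n w) = ((χ σ : ℤ) : ℂ) * ψ w}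
  add_mem' := by
    intro φ ψ hφ hψ σ w
    simp only [Pi.add_apply, hφ σ w, hψ σ w, mul_add]
  zero_mem' := by intro σ w; simp
  smul_mem' := by
    intro c φ hφ σ w
    simp only [Pi.smul_apply, smul_eq_mul, hφ σ w]
    ring

section Equivariant

variable (χ : Equiv.Perm Corner →* ℤˣ)

/-- Pull-back of functions under the removal of the first letter. -/
def pullback (n : ℕ) : equivariant χ n →ₗ[ℂ] equivariant χ (n + 1) where
  toFun ψ := ⟨fun x => ψ.1 x.2, fun σ x => ψ.2 σ x.2⟩
  map_add' _ _ := rfl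
  map_smul' _ _ := rfl

/-- Summation over the first letter. -/
def fibreSum (n : ℕ) : equivariant χ (n + 1) →ₗ[ℂ] equivariant χ n where
  toFun ψ := ⟨fun w => ∑ d, ψ.1 (d, w), fun σ w => by
    change ∑ d, ψ.1 (d, permWord σ n w) = _ * ∑ d, ψ.1 (d, w)
    rw [← Equiv.sum_comp σ, Finset.mul_sum]
    exact Finset.sum_congr rfl fun d _ => ψ.2 σ (d, w)⟩
  map_add' φ ψ := Subtype.ext (funext fun w => Finset.sum_add_distrib)
  map_smul' c ψ := Subtype.ext (funext fun w =>
    (Finset.mul_sum Finset.univ (fun d => ψ.1 (d, w)) c).symm)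

/-- The operator `ψ ↦ ψ ∘ tau`. -/
def edgeFlip (n : ℕ) : equivariant χ (n + 1) →ₗ[ℂ] equivariant χ (n + 1) where
  toFun ψ := ⟨fun x => ψ.1 (tau n x), fun σ x => by
    rw [← ψ.2 σ (tau n x)]
    exact congrArg ψ.1 (tau_permWord σ x.1 x.2)⟩
  map_add' _ _ := rfl
  map_smul' _ _ := rfl

/-- The adjacency operator of the `n`-triangle with a loop added at each of the three vertices. -/
def wordLaplacian (n : ℕ) : equivariant χ n →ₗ[ℂ] equivariant χ n where
  toFun ψ := ⟨fun w => ∑ d, ψ.1 (tau n (d, w)).2, fun σ w => by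
    change ∑ d, ψ.1 (tau n (d, permWord σ n w)).2 = _ * ∑ d, ψ.1 (tau n (d, w)).2
    rw [← Equiv.sum_comp σ, Finset.mul_sum]
    exact Finset.sum_congr rfl fun d _ => by rw [tau_permWord, ψ.2]⟩
  map_add' φ ψ := Subtype.ext (funext fun w => Finset.sum_add_distrib)
  map_smul' c ψ := Subtype.ext (funext fun w =>
    (Finset.mul_sum Finset.univ (fun d => ψ.1 (tau n (d, w)).2) c).symm)

theorem wordLaplacian_succ (n : ℕ) :
    wordLaplacian χ (n + 1) = pullback χ n ∘ₗ fibreSum χ n - 1 + edgeFlip χ n := by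
  refine LinearMap.ext fun ψ => Subtype.ext (funext ?_)
  rintro ⟨e, w⟩
  change ∑ d, ψ.1 (tau (n + 1) (d, (e, w))).2 = ∑ d, ψ.1 (d, w) - ψ.1 (e, w) + ψ.1 (tau n (e, w))
  rw [← Finset.add_sum_erase _ _ (Finset.mem_univ e),
    ← Finset.add_sum_erase Finset.univ (fun d => ψ.1 (d, w)) (Finset.mem_univ e), tau_self]
  have : ∑ d ∈ Finset.univ.erase e, ψ.1 (tau (n + 1) (d, (e, w))).2 =
      ∑ d ∈ Finset.univ.erase e, ψ.1 (d, w) :=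
    Finset.sum_congr rfl fun d hd => by rw [tau_of_ne (Finset.ne_of_mem_erase hd)]
  rw [this]
  ring

theorem wordLaplacian_eq (n : ℕ) :
    wordLaplacian χ n = fibreSum χ n ∘ₗ edgeFlip χ n ∘ₗ pullback χ n := rfl

theorem card_corner : Fintype.card Corner = 3 := rfl

theorem fibreSum_pullback (n : ℕ) : fibreSum χ n ∘ₗ pullback χ n = (3 : ℂ) • 1 := by
  refine LinearMap.ext fun ψ => Subtype.ext (funext fun w => ?_)
  change ∑ _d : Corner, ψ.1 w = 3 * ψ.1 w
  rw [Finset.sum_const, Finset.card_univ, card_corner, nsmul_eq_mul]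
  rfl

theorem edgeFlip_edgeFlip (n : ℕ) : edgeFlip χ n ∘ₗ edgeFlip χ n = 1 :=
  LinearMap.ext fun ψ => Subtype.ext (funext fun x => congrArg ψ.1 (tau_tau x))

theorem exists_perm_pair {e f : Corner} (h : e ≠ f) :
    ∃ σ : Equiv.Perm Corner, σ Corner.a = e ∧ σ Corner.b = f := by
  revert e f; decide

theorem perm_ext {σ ρ : Equiv.Perm Corner} (ha : σ Corner.a = ρ Corner.a)
    (hb : σ Corner.b = ρ Corner.b) : σ = ρ := by
  revert σ ρ; decide

/-- The words `e e w` carry the equivariant functions of length `n + 1`, and the permutations act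
simply transitively on the pairs `e ≠ f`, so that on the words `e f v` an equivariant function is
determined by arbitrary values on the words `a b v`. -/
noncomputable def splitEquiv (n : ℕ) :
    equivariant χ (n + 2) ≃ₗ[ℂ] equivariant χ (n + 1) × (Word n → ℂ) :=
  LinearEquiv.ofBijective
    { toFun := fun ψ => (⟨fun x => ψ.1 (x.1, x), fun σ x => ψ.2 σ (x.1, x)⟩,
        fun v => ψ.1 (Corner.a, (Corner.b, v)))
      map_add' := fun _ _ => rfl
      map_smul' := fun _ _ => rfl } <| by
    constructor
    · intro φ ψ h
      obtain ⟨h1, h2⟩ := Prod.mk.inj h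
      refine Subtype.ext (funext ?_)
      rintro ⟨e, f, v⟩
      by_cases hef : e = f
      · subst hef
        exact congrFun (congrArg Subtype.val h1) (e, v)
      · obtain ⟨σ, rfl, rfl⟩ := exists_perm_pair hef
        have h3 := φ.2 σ (Corner.a, (Corner.b, permWord σ⁻¹ n v))
        have h4 := ψ.2 σ (Corner.a, (Corner.b, permWord σ⁻¹ n v))
        rw [show φ.1 (Corner.a, (Corner.b, permWord σ⁻¹ n v)) = ψ.1 _ from congrFun h2 _,
          ← h4] at h3
        change φ.1 (_, (_, permWord σ n (permWord σ⁻¹ n v))) =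
          ψ.1 (_, (_, permWord σ n (permWord σ⁻¹ n v))) at h3
        rwa [permWord_permWord_inv] at h3
    · rintro ⟨ψ, u⟩
      choose! s hs using fun x : Corner × Corner => fun h : x.1 ≠ x.2 => exists_perm_pair h
      refine ⟨⟨fun x => if x.1 = x.2.1 then ψ.1 x.2 else
        ((χ (s (x.1, x.2.1)) : ℤ) : ℂ) * u (permWord (s (x.1, x.2.1))⁻¹ n x.2.2), ?_⟩, ?_⟩
      · rintro σ ⟨e, f, v⟩
        change (if σ e = σ f then ψ.1 (permWord σ (n + 1) (f, v)) else
          ((χ (s (σ e, σ f)) : ℤ) : ℂ) *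
          u (permWord (s (σ e, σ f))⁻¹ n (permWord σ n v))) = ((χ σ : ℤ) : ℂ) *
          (if e = f then ψ.1 (f, v) else ((χ (s (e, f)) : ℤ) : ℂ) * u (permWord (s (e, f))⁻¹ n v))
        by_cases hef : e = f
        · rw [if_pos (congrArg σ hef), if_pos hef]
          exact ψ.2 σ _
        · have h1 := hs (σ e, σ f) (σ.injective.ne hef)
          have h2 := hs (e, f) hef
          have h3 : s (σ e, σ f) = σ * s (e, f) :=
            perm_ext (h1.1.trans (congrArg σ h2.1.symm)) (h1.2.trans (congrArg σ h2.2.symm))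
          rw [if_neg (σ.injective.ne hef), if_neg hef, h3, map_mul, mul_inv_rev, permWord_mul,
            permWord_inv_permWord, Units.val_mul, Int.cast_mul, mul_assoc]
      · refine Prod.ext (Subtype.ext (funext fun x => if_pos rfl)) (funext fun v => ?_)
        have h1 := hs (Corner.a, Corner.b) (by decide)
        have h2 : s (Corner.a, Corner.b) = 1 := perm_ext h1.1 h1.2
        change (if Corner.a = Corner.b then ψ.1 (Corner.b, v) else
          ((χ (s (Corner.a, Corner.b)) : ℤ) : ℂ) *
          u (permWord (s (Corner.a, Corner.b))⁻¹ n v)) = u v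
        rw [if_neg (by decide), h2, map_one, inv_one, permWord_one, Units.val_one, Int.cast_one,
          one_mul]

/-- The part of `edgeFlip` which acts on the functions on the words `a b v`. -/
noncomputable def offDiagonal (n : ℕ) : (Word n → ℂ) →ₗ[ℂ] (Word n → ℂ) :=
  ((χ (Equiv.swap Corner.a Corner.b) : ℤ) : ℂ) •
    LinearMap.funLeft ℂ ℂ (permWord (Equiv.swap Corner.a Corner.b) n)

theorem splitEquiv_conj_edgeFlip (n : ℕ) :
    (splitEquiv χ n).conj (edgeFlip χ (n + 1)) = (edgeFlip χ n).prodMap (offDiagonal χ n) := by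
  rw [LinearEquiv.conj_apply]
  refine LinearMap.ext fun x => ?_
  obtain ⟨ψ, rfl⟩ := (splitEquiv χ n).surjective x
  rw [LinearMap.comp_apply, LinearMap.comp_apply, LinearEquiv.coe_coe, LinearEquiv.coe_coe,
    LinearEquiv.symm_apply_apply]
  refine Prod.ext (Subtype.ext (funext fun x => ?_)) (funext fun v => ?_)
  · change ψ.1 (tau (n + 1) (x.1, (x.1, x.2))) = ψ.1 ((tau n x).1, tau n x)
    rw [tau_self]
    rfl
  · change ψ.1 (tau (n + 1) (Corner.a, (Corner.b, v))) =
      ((χ (Equiv.swap Corner.a Corner.b) : ℤ) : ℂ) *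
        ψ.1 (Corner.a, (Corner.b, permWord (Equiv.swap Corner.a Corner.b) n v))
    rw [tau_of_ne (by decide)]
    refine Eq.trans ?_ (ψ.2 (Equiv.swap Corner.a Corner.b) _)
    change _ = ψ.1 (Equiv.swap Corner.a Corner.b Corner.a, (Equiv.swap Corner.a Corner.b Corner.b,
      permWord (Equiv.swap Corner.a Corner.b) n (permWord (Equiv.swap Corner.a Corner.b) n v)))
    rw [← permWord_mul, Equiv.swap_mul_self, permWord_one, Equiv.swap_apply_left,
      Equiv.swap_apply_right]
    rfl

theorem permWord_swap_eq_self_iff : ∀ {n : ℕ} {v : Word n},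
    permWord (Equiv.swap Corner.a Corner.b) n v = v ↔ v = diag Corner.c n
  | 0, _ => iff_of_true rfl rfl
  | n + 1, (d, v) => by
    have h : ∀ d : Corner, Equiv.swap Corner.a Corner.b d = d ↔ d = Corner.c := by decide
    change (_, _) = (_, _) ↔ (_, _) = (_, _)
    rw [Prod.mk.injEq, Prod.mk.injEq, permWord_swap_eq_self_iff, h]

theorem trace_offDiagonal (n : ℕ) : LinearMap.trace ℂ _ (offDiagonal χ n) =
    ((χ (Equiv.swap Corner.a Corner.b) : ℤ) : ℂ) := by
  rw [offDiagonal, map_smul, LinearMap.trace_eq_matrix_trace ℂ (Pi.basisFun ℂ (Word n)),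
    Matrix.trace, Finset.sum_eq_single (diag Corner.c n)]
  · rw [Matrix.diag_apply, LinearMap.toMatrix_apply, Pi.basisFun_apply, Pi.basisFun_repr,
      LinearMap.funLeft_apply, permWord_swap_eq_self_iff.2 rfl, Pi.single_eq_same, smul_eq_mul,
      mul_one]
  · intro v _ hv
    rw [Matrix.diag_apply, LinearMap.toMatrix_apply, Pi.basisFun_apply, Pi.basisFun_repr,
      LinearMap.funLeft_apply, Pi.single_eq_of_ne]
    exact fun h => hv (permWord_swap_eq_self_iff.1 h)
  · exact fun h => absurd (Finset.mem_univ _) h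

theorem card_word : ∀ n : ℕ, Fintype.card (Word n) = 3 ^ n
  | 0 => rfl
  | n + 1 => by
    have h : Fintype.card (Word (n + 1)) = Fintype.card Corner * Fintype.card (Word n) :=
      Fintype.card_prod Corner (Word n)
    rw [h, card_word n, card_corner, pow_succ, mul_comm]

theorem finrank_equivariant (n : ℕ) : 2 * Module.finrank ℂ (equivariant χ (n + 1)) + 1 =
    3 ^ n + 2 * Module.finrank ℂ (equivariant χ 1) := by
  induction n with
  | zero => rw [pow_zero]; exact add_comm _ _
  | succ n ih =>
    rw [(splitEquiv χ n).finrank_eq, Module.finrank_prod, Module.finrank_fintype_fun_eq_card,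
      card_word, pow_succ]
    omega

theorem trace_edgeFlip (n : ℕ) : LinearMap.trace ℂ _ (edgeFlip χ n) =
    Module.finrank ℂ (equivariant χ 1) + n * ((χ (Equiv.swap Corner.a Corner.b) : ℤ) : ℂ) := by
  induction n with
  | zero =>
    have : edgeFlip χ 0 = 1 := rfl
    rw [this, LinearMap.trace_one, Nat.cast_zero, zero_mul, add_zero]
  | succ n ih =>
    rw [← LinearMap.trace_conj' (edgeFlip χ (n + 1)) (splitEquiv χ n), splitEquiv_conj_edgeFlip]
    have := LinearMap.congr_fun (LinearMap.trace_prodMap ℂ (equivariant χ (n + 1)) (Word n → ℂ))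
      (edgeFlip χ n, offDiagonal χ n)
    refine Eq.trans this ?_
    change LinearMap.trace ℂ _ (edgeFlip χ n) + LinearMap.trace ℂ _ (offDiagonal χ n) = _
    rw [ih, trace_offDiagonal]
    push_cast
    ring

/-- The recursion for characteristic polynomials, with the multiplicities `k`, `l` of the
eigenvalues `1`, `-1` of `edgeFlip` determined by its trace and by the dimension. -/
theorem exists_charpoly_wordLaplacian_succ (n : ℕ) : ∃ k l : ℕ,
    k + l = Module.finrank ℂ (equivariant χ (n + 1)) ∧
    (k : ℤ) - l = Module.finrank ℂ (equivariant χ 1) +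
      n * (χ (Equiv.swap Corner.a Corner.b) : ℤ) ∧
    (wordLaplacian χ (n + 1)).charpoly *
        (X * (X + 2)) ^ Module.finrank ℂ (equivariant χ n) =
      X ^ k * (X + 2) ^ l * (wordLaplacian χ n).charpoly.comp (X ^ 2 - X - 3) := by
  obtain ⟨k, l, h1, h2, h3⟩ := exists_charpoly_of_involution _ (edgeFlip_edgeFlip χ n)
  refine ⟨k, l, h1, ?_, ?_⟩
  · rw [trace_edgeFlip] at h2
    exact_mod_cast h2
  · rw [wordLaplacian_succ, charpoly_mul_pow_finrank _ _ _ (fibreSum_pullback χ n)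
      (edgeFlip_edgeFlip χ n),
      ← wordLaplacian_eq, h3]
    congr 1
    simp only [mul_comp, pow_comp, sub_comp, add_comp, X_comp, one_comp]
    ring

end Equivariant

/-! ### The characteristic polynomials on words -/

theorem fIter_zero : fIter 0 = X := rfl

theorem fIter_comp (p : ℕ) : (fIter p).comp (X ^ 2 - X - 3) = fIter (p + 1) := by
  induction p with
  | zero => rw [fIter_zero, X_comp]; exact comp_X.symm
  | succ p ih =>
    have h : ∀ q, fIter (q + 1) = (X ^ 2 - X - 3 : ℂ[X]).comp (fIter q) :=
      fun q => Function.iterate_succ_apply' _ _ _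
    rw [h p, comp_assoc, ih, ← h]

theorem expPlus_succ (n p : ℕ) : expPlus (n + 1) (p + 1) = expPlus n p := by
  unfold expPlus
  rw [show n + 1 - 2 - (p + 1) = n - 2 - p by omega]
  congr 1; omega

theorem expMinus_succ (n p : ℕ) : expMinus (n + 1) (p + 1) = expMinus n p := by
  unfold expMinus
  rw [show n + 1 - 2 - (p + 1) = n - 2 - p by omega]
  congr 1; omega

theorem prod_fIter_succ (e₁ e₂ : ℕ → ℕ → ℕ) (h₁ : ∀ n p, e₁ (n + 1) (p + 1) = e₁ n p)
    (h₂ : ∀ n p, e₂ (n + 1) (p + 1) = e₂ n p) (n : ℕ) :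
    ∏ p ∈ Finset.range (n + 1), fIter p ^ e₁ (n + 2) p * (fIter p + 2) ^ e₂ (n + 2) p =
      (∏ p ∈ Finset.range n, fIter p ^ e₁ (n + 1) p * (fIter p + 2) ^ e₂ (n + 1) p).comp
        (X ^ 2 - X - 3) * (X ^ e₁ (n + 2) 0 * (X + 2) ^ e₂ (n + 2) 0) := by
  rw [Finset.prod_range_succ', prod_comp, fIter_zero]
  congr 1
  refine Finset.prod_congr rfl fun p _ => ?_
  rw [mul_comp, pow_comp, pow_comp, add_comp, fIter_comp, h₁, h₂]
  rw [show (2 : ℂ[X]).comp (X ^ 2 - X - 3) = 2 by rw [ofNat_comp]; rfl]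

theorem mem_equivariant_one_iff_const {ψ : Word 1 → ℂ} :
    ψ ∈ equivariant 1 1 ↔ ∀ w w', ψ w = ψ w' := by
  constructor
  · rintro h ⟨d, ⟨⟩⟩ ⟨e, ⟨⟩⟩
    have := h (Equiv.swap e d) (e, ())
    rw [MonoidHom.one_apply, Units.val_one, Int.cast_one, one_mul] at this
    change ψ (Equiv.swap e d e, ()) = _ at this
    rwa [Equiv.swap_apply_left] at this
  · intro h σ w
    rw [MonoidHom.one_apply, Units.val_one, Int.cast_one, one_mul]
    exact h _ _

theorem finrank_equivariant_one : Module.finrank ℂ (equivariant 1 1) = 1 := by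
  refine finrank_eq_one (⟨fun _ => 1, mem_equivariant_one_iff_const.2 fun _ _ => rfl⟩)
    (fun h => one_ne_zero (congrFun (congrArg Subtype.val h) (Corner.a, ()))) fun ψ => ?_
  refine ⟨ψ.1 (Corner.a, ()), Subtype.ext (funext fun w => ?_)⟩
  exact (mul_one _).trans (mem_equivariant_one_iff_const.1 ψ.2 _ _)

theorem finrank_equivariant_sign : Module.finrank ℂ (equivariant Equiv.Perm.sign 1) = 0 := by
  have : Subsingleton (equivariant Equiv.Perm.sign 1) := by
    refine ⟨fun φ ψ => ?_⟩
    have key : ∀ φ : equivariant Equiv.Perm.sign 1, ∀ w, φ.1 w = 0 := by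
      rintro φ ⟨d, ⟨⟩⟩
      -- the transposition of the two other letters fixes the word `d`
      have hd : ∀ d : Corner, ∃ σ : Equiv.Perm Corner, σ d = d ∧ Equiv.Perm.sign σ = -1 := by
        decide
      obtain ⟨σ, h1, h2⟩ := hd d
      have := φ.2 σ (d, ())
      change φ.1 (σ d, ()) = _ at this
      rw [h1, h2, Units.val_neg, Units.val_one, Int.cast_neg, Int.cast_one, neg_one_mul] at this
      exact self_eq_neg.1 this
    exact Subtype.ext (funext fun w => by rw [key, key])
  exact Module.finrank_zero_of_subsingleton

theorem charpoly_wordLaplacian_one (n : ℕ) : (wordLaplacian 1 (n + 1)).charpoly =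
    (X - 3) * ∏ p ∈ Finset.range n,
      fIter p ^ expPlus (n + 1) p * (fIter p + 2) ^ expMinus (n + 1) p := by
  induction n with
  | zero =>
    have h : wordLaplacian 1 1 = (3 : ℂ) • 1 := by
      refine LinearMap.ext fun ψ => Subtype.ext (funext fun w => ?_)
      change ∑ d, ψ.1 (tau 1 (d, w)).2 = 3 * ψ.1 w
      rw [Finset.sum_congr rfl fun d _ => mem_equivariant_one_iff_const.1 ψ.2 _ w,
        Finset.sum_const, Finset.card_univ, card_corner, nsmul_eq_mul]
      rfl
    rw [h, charpoly_smul_one, finrank_equivariant_one, pow_one, Finset.prod_range_zero, mul_one]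
    rfl
  | succ n ih =>
    obtain ⟨k, l, h1, h2, h3⟩ := exists_charpoly_wordLaplacian_succ 1 (n + 1)
    rw [ih] at h3
    rw [prod_fIter_succ _ _ expPlus_succ expMinus_succ]
    set Q := ∏ p ∈ Finset.range n, fIter p ^ expPlus (n + 1) p * (fIter p + 2) ^ expMinus (n + 1) p
    have hd := finrank_equivariant 1 n
    have hd' := finrank_equivariant 1 (n + 1)
    rw [finrank_equivariant_one] at hd hd' h2
    rw [MonoidHom.one_apply, Units.val_one, mul_one] at h2
    have he := exp_exact (n := n + 2) (p := 0) (by omega)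
    rw [show n + 2 - 2 - 0 = n by omega] at he
    rw [pow_succ] at hd'
    set d := Module.finrank ℂ (equivariant 1 (n + 1))
    have hk : k = d + expPlus (n + 2) 0 := by
      zify at *
      push_cast at *
      linarith [he.1]
    have hl : l + 1 = d + expMinus (n + 2) 0 := by
      zify at *
      push_cast at *
      linarith [he.2]
    have hX : (X * (X + 2) : ℂ[X]) ^ d ≠ 0 := by
      refine pow_ne_zero _ (mul_ne_zero X_ne_zero ?_)
      exact (monic_X_add_C (2 : ℂ)).ne_zero
    refine mul_right_cancel₀ hX (h3.trans ?_)
    have hc : (X - 3 : ℂ[X]).comp (X ^ 2 - X - 3) = (X - 3) * (X + 2) := by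
      rw [sub_comp, X_comp, ofNat_comp]; ring
    rw [mul_comp, hc, hk, mul_pow, pow_add]
    have hl' : (X + 2 : ℂ[X]) ^ l * (X + 2) = (X + 2) ^ d * (X + 2) ^ expMinus (n + 2) 0 := by
      rw [← pow_succ, hl, pow_add]
    linear_combination (X ^ d * X ^ expPlus (n + 2) 0 * (X - 3) * Q.comp (X ^ 2 - X - 3)) * hl'

theorem charpoly_wordLaplacian_sign (n : ℕ) : (wordLaplacian Equiv.Perm.sign (n + 1)).charpoly =
    ∏ p ∈ Finset.range n,
      fIter p ^ expMinus (n + 1) p * (fIter p + 2) ^ expPlus (n + 1) p := by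
  induction n with
  | zero =>
    rw [Finset.prod_range_zero]
    refine eq_one_of_monic_natDegree_zero (LinearMap.charpoly_monic _) ?_
    rw [LinearMap.charpoly_natDegree]
    exact finrank_equivariant_sign
  | succ n ih =>
    obtain ⟨k, l, h1, h2, h3⟩ := exists_charpoly_wordLaplacian_succ Equiv.Perm.sign (n + 1)
    rw [ih] at h3
    rw [prod_fIter_succ _ _ expMinus_succ expPlus_succ]
    set Q := ∏ p ∈ Finset.range n, fIter p ^ expMinus (n + 1) p * (fIter p + 2) ^ expPlus (n + 1) p
    have hd := finrank_equivariant Equiv.Perm.sign n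
    have hd' := finrank_equivariant Equiv.Perm.sign (n + 1)
    rw [finrank_equivariant_sign] at hd hd' h2
    rw [Equiv.Perm.sign_swap (by decide), Units.val_neg, Units.val_one] at h2
    have he := exp_exact (n := n + 2) (p := 0) (by omega)
    rw [show n + 2 - 2 - 0 = n by omega] at he
    rw [pow_succ] at hd'
    set d := Module.finrank ℂ (equivariant Equiv.Perm.sign (n + 1))
    have hk : k = d + expMinus (n + 2) 0 := by
      zify at *
      push_cast at *
      linarith [he.2]
    have hl : l = d + expPlus (n + 2) 0 := by
      zify at *
      push_cast at *
      linarith [he.1]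
    have hX : (X * (X + 2) : ℂ[X]) ^ d ≠ 0 := by
      refine pow_ne_zero _ (mul_ne_zero X_ne_zero ?_)
      exact (monic_X_add_C (2 : ℂ)).ne_zero
    refine mul_right_cancel₀ hX (h3.trans ?_)
    rw [hk, hl, mul_pow, pow_add, pow_add]
    ring

/-! ### Triangular functions as functions on words -/

/-- The function on `Γ̄` which an equivariant function on words defines through addresses. -/
noncomputable def onBar (χ : Equiv.Perm Corner →* ℤˣ) (n : ℕ) :
    equivariant χ n →ₗ[ℂ] (pascalBar → ℂ) :=
  LinearMap.funLeft ℂ ℂ (address n) ∘ₗ (equivariant χ n).subtype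

theorem onBar_apply (χ : Equiv.Perm Corner →* ℤˣ) (n : ℕ) (ψ : equivariant χ n) (p : pascalBar) :
    onBar χ n ψ p = ψ.1 (address n p) := rfl

theorem address_surjective (n : ℕ) : Function.Surjective (address n) := fun w =>
  ⟨fillEquiv n (w, ⟨basePoint, basePoint_mem_pascalBar⟩), address_fillEquiv _ _⟩

theorem onBar_injective (χ : Equiv.Perm Corner →* ℤˣ) (n : ℕ) :
    Function.Injective (onBar χ n) :=
  fun _ _ h => Subtype.ext
    (LinearMap.funLeft_injective_of_surjective ℂ ℂ (address n) (address_surjective n) h)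

/-- The edges which leave an `n`-triangle join vertices of `n`-triangles, on which an equivariant
function takes a single value; there the loop of `wordLaplacian` accounts for the outer
neighbour. -/
theorem laplacian_onBar (χ : Equiv.Perm Corner →* ℤˣ) (n : ℕ) (ψ : equivariant χ n) :
    laplacian (onBar χ n ψ) = onBar χ n (wordLaplacian χ n ψ) := by
  have hdiag : ∀ d e, ψ.1 (diag d n) = ψ.1 (diag e n) := by
    intro d e
    have h : ∀ d e : Corner, ∃ σ : Equiv.Perm Corner, (σ * σ) e = d := by decide
    obtain ⟨σ, rfl⟩ := h d e
    rw [← permWord_diag, ψ.2, map_mul, Int.units_mul_self, Units.val_one, Int.cast_one, one_mul]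
  funext p
  obtain ⟨w, r, rfl⟩ := exists_eq_fillEquiv n p
  rw [laplacian_apply, onBar_apply, address_fillEquiv]
  change _ = ∑ d, ψ.1 (tau n (d, w)).2
  refine Finset.sum_congr rfl fun d _ => ?_
  rw [onBar_apply]
  rcases nbr_fillEquiv_cases d w r with ⟨-, h⟩ | ⟨h1, h2, h3⟩
  · rw [h, address_fillEquiv]
  · rw [h3, address_fillEquiv, h1, h2]
    exact hdiag _ _

theorem perm_mem_of_generators (M : Submonoid (Equiv.Perm Corner))
    (h₁ : Equiv.swap Corner.a Corner.b ∈ M)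
    (h₂ : Equiv.swap Corner.a Corner.c * Equiv.swap Corner.b Corner.c ∈ M)
    (σ : Equiv.Perm Corner) : σ ∈ M := by
  set s := Equiv.swap Corner.a Corner.b with hs
  set t := Equiv.swap Corner.a Corner.c * Equiv.swap Corner.b Corner.c with ht
  have h : σ = 1 ∨ σ = t ∨ σ = t * t ∨ σ = s ∨ σ = s * t ∨ σ = s * (t * t) := by
    rw [hs, ht]; revert σ; decide
  rcases h with rfl | rfl | rfl | rfl | rfl | rfl
  exacts [M.one_mem, h₂, mul_mem h₂ h₂, h₁, mul_mem h₁ h₂, mul_mem h₁ (mul_mem h₂ h₂)]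

theorem triangular_inf_semiInvariant (χ : Equiv.Perm Corner →* ℤˣ) (χ' : GL (Fin 2) ℤ → ℤˣ)
    (hχ : ∀ s σ, ActsBy s σ → χ' s = χ σ) (n : ℕ) :
    triangular (n + 1) ⊓ semiInvariant χ' = LinearMap.range (onBar χ (n + 1)) := by
  rw [triangular_succ]
  ext φ
  constructor
  · rintro ⟨⟨ψ, rfl⟩, hφ⟩
    let M : Submonoid (Equiv.Perm Corner) :=
      { carrier := {σ | ∀ w, ψ (permWord σ (n + 1) w) = ((χ σ : ℤ) : ℂ) * ψ w}
        one_mem' := fun w => by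
          rw [permWord_one, map_one, Units.val_one, Int.cast_one, one_mul]
        mul_mem' := fun {σ ρ} hσ hρ w => by
          rw [permWord_mul, hσ, hρ, map_mul, Units.val_mul, Int.cast_mul, mul_assoc] }
    have hM : ∀ s ∈ symGroup, ∀ σ, ActsBy s σ → σ ∈ M := by
      intro s hs σ h w
      obtain ⟨p, rfl⟩ := address_surjective (n + 1) w
      have h1 := hφ s hs p ⟨act s p.1, h.1 _ p.2⟩ rfl
      rw [LinearMap.funLeft_apply, LinearMap.funLeft_apply, h.address rfl, hχ s σ h] at h1
      exact h1
    refine ⟨⟨ψ, fun σ => perm_mem_of_generators M ?_ ?_ σ⟩, rfl⟩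
    · exact hM _ (Subgroup.subset_closure (Set.mem_insert _ _)) _ actsBy_elemI
    · exact hM _ (Subgroup.subset_closure (Set.mem_insert_of_mem _ rfl)) _ actsBy_elemR
  · rintro ⟨ψ, rfl⟩
    refine ⟨⟨ψ.1, rfl⟩, fun s hs p q hq => ?_⟩
    obtain ⟨σ, hσ⟩ := exists_actsBy hs
    rw [onBar_apply, onBar_apply, hσ.address hq, ψ.2, hχ s σ hσ]

theorem charpoly_restrict_laplacian (χ : Equiv.Perm Corner →* ℤˣ) (n : ℕ)
    (W : Submodule ℂ (pascalBar → ℂ)) (hW : W = LinearMap.range (onBar χ n)) :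
    ∃ (_ : FiniteDimensional ℂ W) (hst : ∀ φ ∈ W, laplacian φ ∈ W),
      (laplacian.restrict hst).charpoly = (wordLaplacian χ n).charpoly := by
  subst hW
  let e := LinearEquiv.ofInjective (onBar χ n) (onBar_injective χ n)
  have hst : ∀ φ ∈ LinearMap.range (onBar χ n), laplacian φ ∈ LinearMap.range (onBar χ n) := by
    rintro _ ⟨ψ, rfl⟩
    exact ⟨_, (laplacian_onBar χ n ψ).symm⟩
  have hconj : laplacian.restrict hst = e.conj (wordLaplacian χ n) := by
    refine LinearMap.ext fun φ => ?_
    obtain ⟨ψ, rfl⟩ := e.surjective φ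
    rw [LinearEquiv.conj_apply_apply, LinearEquiv.symm_apply_apply]
    exact Subtype.ext (laplacian_onBar χ n ψ)
  refine ⟨inferInstance, hst, ?_⟩
  rw [hconj, LinearEquiv.charpoly_conj]

end PascalGraph

open PascalGraph
theorem proposition13p6 :
    (∀ n : ℕ, 1 ≤ n →
      ∃ (_ : FiniteDimensional ℂ (invTriangular n))
        (hst : ∀ φ ∈ invTriangular n, laplacian φ ∈ invTriangular n),
        (laplacian.restrict hst).charpoly =
          (X - 3) * ∏ p ∈ Finset.range (n - 1),
            fIter p ^ expPlus n p * (fIter p + 2) ^ expMinus n p) ∧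
    (∀ n : ℕ, 2 ≤ n →
      ∃ (_ : FiniteDimensional ℂ (signTriangular n))
        (hst : ∀ φ ∈ signTriangular n, laplacian φ ∈ signTriangular n),
        (laplacian.restrict hst).charpoly =
          ∏ p ∈ Finset.range (n - 1),
            fIter p ^ expMinus n p * (fIter p + 2) ^ expPlus n p) := by
  constructor
  · intro n hn
    obtain ⟨n, rfl⟩ := Nat.exists_eq_add_of_le' hn
    obtain ⟨h1, h2, h3⟩ := charpoly_restrict_laplacian 1 (n + 1) (invTriangular (n + 1))
      (triangular_inf_semiInvariant 1 _ (fun _ _ _ => rfl) n)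
    exact ⟨h1, h2, h3.trans (charpoly_wordLaplacian_one n)⟩
  · intro n hn
    obtain ⟨n, rfl⟩ := Nat.exists_eq_add_of_le' (le_of_lt hn)
    obtain ⟨h1, h2, h3⟩ := charpoly_restrict_laplacian Equiv.Perm.sign (n + 1)
      (signTriangular (n + 1)) (triangular_inf_semiInvariant _ _ (fun _ _ h => h.2.1) n)
    exact ⟨h1, h2, h3.trans (charpoly_wordLaplacian_sign n)⟩
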